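/- Let $d\ge 1$. For $t>0$ and $x,y\in\mathbb{R}^d$ let $$G_t(x,y)=\big(2\pi\sinh(2t)\big)^{-d/2}\exp\Big(-\tfrac14\big[\tanh(t)\|x+y\|^2+\coth(t)\|x-y\|^2\big]\Big)$$ be the integral kernel of the semigroup $\exp(-t\mathcal{H})$ generated by the harmonic oscillator $\mathcal{H}=-\Delta+\|x\|^2$, and let $$\mathcal{I}^{d/2}f(x)=\int_{\mathbb{R}^d}\mathcal{K}^{d/2}(x,y)f(y)\,dy,\qquad \mathcal{K}^{d/2}(x,y)=\frac{1}{\Gamma(d/2)}\int_0^\infty G_t(x,y)\,t^{d/2-1}\,dt .$$ Functions are real- or complex-valued and $L^p=L^p(\mathbb{R}^d)$ is taken with respect to Lebesgue measure $|\cdot|$. An operator $T$ defined on $L^p$ with values in measurable functions is of strong type $(p,q)$ (bounded from $L^p$ to $L^q$) if $\|Tf\|_q\le C\|f\|_p$ for all $f\in L^p$, with $C$ independent of $f$. It is of weak type $(p,q)$, $q<\infty$, if $|\{x: |Tf(x)|>\lambda\}|\le C(\|f\|_p/\lambda)^q$ for all $\lambda>0$ and all $f\in L^p$, with $C$ independent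 of $f$ and $\lambda$; weak type $(p,\infty)$ means strong type $(p,\infty)$. It is of restricted weak type $(p,q)$ if the corresponding weak type estimate holds, with one constant $C$, for all $f=\chi_E$ with $E$ measurable of finite measure. The integral defining $\mathcal{K}^{d/2}(x,y)$ converges for all $x\neq y$, and for every $1\le p\le\infty$ and $f\in L^p$ the integral defining $\mathcal{I}^{d/2}f(x)$ converges absolutely for almost every $x$ and gives a measurable function of $x$. Moreover: - $\mathcal{I}^{d/2}$ is bounded from $L^p$ to $L^q$ for all $1\le p,q\le\infty$ with $(p,q)\ne(\infty,1)$ and $(p,q)\ne(1,\infty)$. - $\mathcal{I}^{d/2}$ is of weak type $(\infty,1)$, but not of strong type $(\infty,1)$. - $\mathcal{I}^{d/2}$ is not of restricted weak type $(1,\infty)$; in particular, it is not bounded from $L^1$ to $L^\infty$. -/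

import Mathlib

open MeasureTheory
open scoped ENNReal NNReal

noncomputable section

namespace HarmonicOscillator

/-- The integral kernel `G_t(x, y)`, `t > 0`, of the Hermite semigroup `exp (-t H)`,
`H = -Δ + ‖x‖²`, on `ℝ^d`. -/
def heatKernel (d : ℕ) (t : ℝ) (x y : EuclideanSpace ℝ (Fin d)) : ℝ :=
  (2 * Real.pi * Real.sinh (2 * t)) ^ (-((d : ℝ) / 2)) *
    Real.exp (-(1 / 4) * (Real.tanh t * ‖x + y‖ ^ 2
      + (Real.cosh t / Real.sinh t) * ‖x - y‖ ^ 2))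

/-- The potential kernel `K^σ(x, y) = Γ(σ)⁻¹ ∫₀^∞ G_t(x, y) t^(σ - 1) dt`.
(On the diagonal the integral diverges when `σ ≤ d / 2`; the Bochner integral then returns the
value `0` there. This affects only the null set `y = x` in the potential operator below.) -/
def potentialKernel (d : ℕ) (σ : ℝ) (x y : EuclideanSpace ℝ (Fin d)) : ℝ :=
  (Real.Gamma σ)⁻¹ * ∫ t in Set.Ioi (0 : ℝ), heatKernel d t x y * t ^ (σ - 1)

/-- The potential operator `I^σ f (x) = ∫ K^σ(x, y) f(y) dy`. -/
def potentialOperator (d : ℕ) (σ : ℝ) {𝕜 : Type*} [RCLike 𝕜]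
    (f : EuclideanSpace ℝ (Fin d) → 𝕜) (x : EuclideanSpace ℝ (Fin d)) : 𝕜 :=
  ∫ y, potentialKernel d σ x y • f y

/-- `f` lies in the natural domain of `I^σ`: the integral defining `I^σ f (x)` converges
(absolutely) for almost every `x`. -/
def InPotentialDomain (d : ℕ) (σ : ℝ) {𝕜 : Type*} [RCLike 𝕜]
    (f : EuclideanSpace ℝ (Fin d) → 𝕜) : Prop :=
  ∀ᵐ x : EuclideanSpace ℝ (Fin d), Integrable (fun y => potentialKernel d σ x y • f y)

section Types

variable {d : ℕ} {𝕜 : Type*} [RCLike 𝕜]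

/-- Strong type `(p, q)`: `T` maps `L^p` to `L^q` and `‖T f‖_q ≤ C ‖f‖_p`. -/
def IsStrongType (T : (EuclideanSpace ℝ (Fin d) → 𝕜) → (EuclideanSpace ℝ (Fin d) → 𝕜))
    (p q : ℝ≥0∞) : Prop :=
  ∃ C : ℝ≥0, ∀ f : EuclideanSpace ℝ (Fin d) → 𝕜, MemLp f p volume →
    MemLp (T f) q volume ∧ eLpNorm (T f) q volume ≤ C * eLpNorm f p volume

/-- The single-function estimate behind weak type `(p, q)` with constant `C`. For `q < ∞` it reads
`|{x : |T f (x)| > l}| ≤ C (‖f‖_p / l)^q` for all `l > 0`; for `q = ∞` it reads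
`‖T f‖_∞ ≤ C ‖f‖_p`. -/
def WeakTypeBound (T : (EuclideanSpace ℝ (Fin d) → 𝕜) → (EuclideanSpace ℝ (Fin d) → 𝕜))
    (p q : ℝ≥0∞) (C : ℝ≥0) (f : EuclideanSpace ℝ (Fin d) → 𝕜) : Prop :=
  AEStronglyMeasurable (T f) volume ∧
    (q ≠ ∞ → ∀ l : ℝ, 0 < l →
      volume {x | l < ‖T f x‖} ≤ C * (eLpNorm f p volume / ENNReal.ofReal l) ^ q.toReal) ∧
    (q = ∞ → eLpNorm (T f) ∞ volume ≤ C * eLpNorm f p volume)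

/-- Weak type `(p, q)`: the weak type bound holds on all of `L^p` with one constant. -/
def IsWeakType (T : (EuclideanSpace ℝ (Fin d) → 𝕜) → (EuclideanSpace ℝ (Fin d) → 𝕜))
    (p q : ℝ≥0∞) : Prop :=
  ∃ C : ℝ≥0, ∀ f : EuclideanSpace ℝ (Fin d) → 𝕜, MemLp f p volume → WeakTypeBound T p q C f

/-- Restricted weak type `(p, q)`: the weak type bound holds, with one constant, for all
characteristic functions of measurable sets of finite measure. -/
def IsRestrictedWeakType
    (T : (EuclideanSpace ℝ (Fin d) → 𝕜) → (EuclideanSpace ℝ (Fin d) → 𝕜))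
    (p q : ℝ≥0∞) : Prop :=
  ∃ C : ℝ≥0, ∀ E : Set (EuclideanSpace ℝ (Fin d)), MeasurableSet E → volume E < ∞ →
    WeakTypeBound T p q C (E.indicator fun _ => (1 : 𝕜))

end Types

end HarmonicOscillator

end

/-! Write `θ = |1/p - 1/q|`. The heat kernel `G_t` is symmetric, its row integrals are at most `A =
(2π)^(d/2) e^(-dt/2)`, and both its supremum and its total mass are at most `A t^(-d/2)`.
Interpolating between the Schur test and the corners `(1, ∞)` and `(∞, 1)` (`eLpNorm_kernel_le`)
gives `‖exp(-tH)‖_{p→q} ≤ A t^(-θd/2)`. By Minkowski (`eLpNorm_lintegral_le`) the potential operator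
has norm at most a constant times `∫ t^((1-θ)d/2 - 1) e^(-dt/2) dt`. This is finite exactly when `θ
< 1`, that is, away from the two excluded pairs.

At these pairs the integral becomes `∫ dt/t` near `0`, and the divergence is genuine. For `(∞, 1)`,
integrating `G_t` in both variables gives a multiple of `sinh(2t)^(-d/2)`, so the potential of `1`
is not integrable; but it is `O(‖x‖^(-d))` (`lintegral_enorm_potentialKernel_le`), which lies in
weak `L^1`. For `(1, ∞)`, the kernel has a logarithmic singularity on the diagonal
(`exists_forall_le_potentialKernel`), so indicators of small balls defeat any constant. -/

namespace HarmonicOscillator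

/-! ### Integral inequalities for nonnegative kernels -/

section Abstract

variable {α τ : Type*} [MeasurableSpace α] [MeasurableSpace τ]

/-- Jensen's inequality for a weighted integral. -/
theorem lintegral_mul_rpow_le {μ : Measure α} {k f : α → ℝ≥0∞} (hk : AEMeasurable k μ)
    (hf : AEMeasurable f μ) {p : ℝ} (hp : 1 ≤ p) :
    (∫⁻ a, k a * f a ∂μ) ^ p ≤ (∫⁻ a, k a ∂μ) ^ (p - 1) * ∫⁻ a, k a * f a ^ p ∂μ := by
  have hp0 : 0 < p := by linarith
  have hpi : 0 ≤ 1 - p⁻¹ := by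
    have := inv_le_one_of_one_le₀ hp
    linarith
  have hkf : AEMeasurable (fun a => k a * f a ^ p) μ := hk.mul (hf.pow_const p)
  -- Hölder with weights `1 - 1/p` and `1/p`, for `k f = k^(1 - 1/p) (k f^p)^(1/p)`.
  have h := ENNReal.lintegral_mul_norm_pow_le hk hkf hpi (inv_nonneg.2 hp0.le) (by ring)
  have hpt : ∀ a, k a ^ (1 - p⁻¹) * (k a * f a ^ p) ^ p⁻¹ = k a * f a := by
    intro a
    rw [ENNReal.mul_rpow_of_nonneg _ _ (inv_nonneg.2 hp0.le), ← mul_assoc,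
      ← ENNReal.rpow_add_of_nonneg _ _ hpi (inv_nonneg.2 hp0.le), ← ENNReal.rpow_mul,
      mul_inv_cancel₀ hp0.ne']
    simp
  simp only [hpt] at h
  calc (∫⁻ a, k a * f a ∂μ) ^ p
      ≤ ((∫⁻ a, k a ∂μ) ^ (1 - p⁻¹) * (∫⁻ a, k a * f a ^ p ∂μ) ^ p⁻¹) ^ p := by gcongr
    _ = _ := by
      rw [ENNReal.mul_rpow_of_nonneg _ _ hp0.le, ← ENNReal.rpow_mul, ← ENNReal.rpow_mul,
        inv_mul_cancel₀ hp0.ne', ENNReal.rpow_one]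
      congr 2
      field_simp

theorem eLpNorm_le_of_lintegral_rpow_le {μ : Measure α} {g : α → ℝ≥0∞} {q : ℝ≥0∞} (hq : 1 ≤ q)
    (hq' : q ≠ ∞) {D : ℝ≥0∞} (h : ∫⁻ x, g x ^ q.toReal ∂μ ≤ D ^ q.toReal) :
    eLpNorm g q μ ≤ D := by
  have hq0 : q ≠ 0 := (zero_lt_one.trans_le hq).ne'
  have hqr : 0 < q.toReal := ENNReal.toReal_pos hq0 hq'
  rw [eLpNorm_eq_lintegral_rpow_enorm_toReal hq0 hq', one_div, ENNReal.rpow_inv_le_iff hqr]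
  simpa using h

theorem lintegral_rpow_eq_eLpNorm_rpow {μ : Measure α} {f : α → ℝ≥0∞} {p : ℝ≥0∞} (hp : 1 ≤ p)
    (hp' : p ≠ ∞) : ∫⁻ x, f x ^ p.toReal ∂μ = eLpNorm f p μ ^ p.toReal := by
  have hp0 : p ≠ 0 := (zero_lt_one.trans_le hp).ne'
  have hpr : 0 < p.toReal := ENNReal.toReal_pos hp0 hp'
  rw [eLpNorm_eq_lintegral_rpow_enorm_toReal hp0 hp', one_div, ENNReal.rpow_inv_rpow hpr.ne']
  simp

/-- Minkowski's integral inequality, with a measurable majorant of the norms of the slices. -/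
theorem eLpNorm_lintegral_le {μ : Measure α} {ν : Measure τ} [SFinite μ] [SFinite ν]
    {h : τ → α → ℝ≥0∞} (hh : Measurable (Function.uncurry h)) {b : τ → ℝ≥0∞} (hb : Measurable b)
    (hb0 : ∀ᵐ t ∂ν, b t ≠ 0) (hbt : ∀ᵐ t ∂ν, b t ≠ ∞) {q : ℝ≥0∞} (hq : 1 ≤ q) {N : ℝ≥0∞}
    (hN : ∀ᵐ t ∂ν, eLpNorm (h t) q μ ≤ b t * N) :
    eLpNorm (fun x => ∫⁻ t, h t x ∂ν) q μ ≤ (∫⁻ t, b t ∂ν) * N := by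
  by_cases hq' : q = ∞
  · subst hq'
    have h1 : ∀ᵐ t ∂ν, ∀ᵐ x ∂μ, h t x ≤ b t * N := by
      filter_upwards [hN] with t ht
      rw [eLpNorm_exponent_top] at ht
      filter_upwards [enorm_ae_le_eLpNormEssSup (h t) μ] with x hx
      exact hx.trans ht
    have hms : MeasurableSet {z : τ × α | h z.1 z.2 ≤ b z.1 * N} :=
      measurableSet_le hh ((hb.comp measurable_fst).mul_const N)
    have h2 : ∀ᵐ x ∂μ, ∀ᵐ t ∂ν, h t x ≤ b t * N := (Measure.ae_ae_comm hms).1 h1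
    rw [eLpNorm_exponent_top]
    refine essSup_le_of_ae_le _ ?_
    filter_upwards [h2] with x hx
    calc ∫⁻ t, h t x ∂ν ≤ ∫⁻ t, b t * N ∂ν := lintegral_mono_ae hx
      _ = _ := lintegral_mul_const _ hb
  -- No duality is needed: write `h = b · (h / b)`, apply Jensen with weight `b` in `t`, and
  -- exchange the integrals; each slice of `h / b` has norm at most `N`.
  · have hq1 : 1 ≤ q.toReal := by
      simpa using (ENNReal.toReal_le_toReal ENNReal.one_ne_top hq').2 hq
    have hq0 : 0 < q.toReal := by linarith
    refine eLpNorm_le_of_lintegral_rpow_le hq hq' ?_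
    have hm : Measurable (Function.uncurry fun t x => b t * ((h t x / b t) ^ q.toReal)) :=
      (hb.comp measurable_fst).mul ((hh.div (hb.comp measurable_fst)).pow_const _)
    have hpt : ∀ x, (∫⁻ t, h t x ∂ν) ^ q.toReal ≤
        (∫⁻ t, b t ∂ν) ^ (q.toReal - 1) * ∫⁻ t, b t * ((h t x / b t) ^ q.toReal) ∂ν := by
      intro x
      have : ∫⁻ t, h t x ∂ν = ∫⁻ t, b t * (h t x / b t) ∂ν := by
        refine lintegral_congr_ae ?_
        filter_upwards [hb0, hbt] with t h0 ht
        rw [ENNReal.mul_div_cancel h0 ht]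
      rw [this]
      have hhx : Measurable fun t => h t x := hh.comp (measurable_id.prodMk measurable_const)
      exact lintegral_mul_rpow_le hb.aemeasurable (hhx.div hb).aemeasurable hq1
    calc ∫⁻ x, (∫⁻ t, h t x ∂ν) ^ q.toReal ∂μ
        ≤ ∫⁻ x, (∫⁻ t, b t ∂ν) ^ (q.toReal - 1) *
            ∫⁻ t, b t * ((h t x / b t) ^ q.toReal) ∂ν ∂μ := lintegral_mono hpt
      _ = (∫⁻ t, b t ∂ν) ^ (q.toReal - 1) *
            ∫⁻ x, ∫⁻ t, b t * ((h t x / b t) ^ q.toReal) ∂ν ∂μ :=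
          lintegral_const_mul _ (hm.lintegral_prod_left' (μ := ν))
      _ = (∫⁻ t, b t ∂ν) ^ (q.toReal - 1) *
            ∫⁻ t, ∫⁻ x, b t * ((h t x / b t) ^ q.toReal) ∂μ ∂ν := by
          rw [lintegral_lintegral_swap]
          exact (hm.comp measurable_swap).aemeasurable
      _ ≤ (∫⁻ t, b t ∂ν) ^ (q.toReal - 1) * ∫⁻ t, b t * N ^ q.toReal ∂ν := by
          refine mul_le_mul_right ?_ _
          refine lintegral_mono_ae ?_
          filter_upwards [hb0, hbt, hN] with t h0 ht htN
          have hht : Measurable (h t) := hh.comp (measurable_const.prodMk measurable_id)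
          rw [lintegral_const_mul _ ((hht.div_const _).pow_const _)]
          gcongr
          have : ∀ x, (h t x / b t) ^ q.toReal = (b t)⁻¹ ^ q.toReal * h t x ^ q.toReal := by
            intro x
            rw [div_eq_mul_inv, mul_comm, ENNReal.mul_rpow_of_nonneg _ _ hq0.le]
          simp only [this]
          rw [lintegral_const_mul _ (hht.pow_const _), lintegral_rpow_eq_eLpNorm_rpow hq hq',
            ← ENNReal.mul_rpow_of_nonneg _ _ hq0.le]
          gcongr
          calc (b t)⁻¹ * eLpNorm (h t) q μ ≤ (b t)⁻¹ * (b t * N) := by gcongr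
            _ = N := by rw [← mul_assoc, ENNReal.inv_mul_cancel h0 ht, one_mul]
      _ = ((∫⁻ t, b t ∂ν) * N) ^ q.toReal := by
          rw [lintegral_mul_const _ hb, ENNReal.mul_rpow_of_nonneg _ _ hq0.le, ← mul_assoc]
          congr 1
          nth_rw 2 [← ENNReal.rpow_one (∫⁻ t, b t ∂ν)]
          rw [← ENNReal.rpow_add_of_nonneg _ _ (by linarith) zero_le_one]
          congr 1
          ring

variable {μ : Measure α} [SFinite μ] {k : α → α → ℝ≥0∞} {f : α → ℝ≥0∞} {A S : ℝ≥0∞}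

theorem lintegral_lintegral_mul_le (hk : Measurable (Function.uncurry k)) (hf : AEMeasurable f μ)
    (hcol : ∀ y, ∫⁻ x, k x y ∂μ ≤ A) :
    ∫⁻ x, ∫⁻ y, k x y * f y ∂μ ∂μ ≤ A * ∫⁻ y, f y ∂μ := by
  rw [lintegral_lintegral_swap (hk.aemeasurable.mul hf.comp_snd)]
  calc ∫⁻ y, ∫⁻ x, k x y * f y ∂μ ∂μ = ∫⁻ y, (∫⁻ x, k x y ∂μ) * f y ∂μ := by
        refine lintegral_congr fun y => ?_
        exact lintegral_mul_const _ (hk.comp (measurable_id.prodMk measurable_const))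
    _ ≤ ∫⁻ y, A * f y ∂μ := by
        gcongr with y
        exact hcol y
    _ = A * ∫⁻ y, f y ∂μ := lintegral_const_mul'' _ hf

/-- An integral operator whose kernel is bounded, is integrable, and has bounded row and column
integrals maps every `L^p` to every `L^q`, with a bound interpolating between the Schur test and
the two extreme pairs of exponents. -/
theorem eLpNorm_kernel_le (hk : Measurable (Function.uncurry k)) (hf : AEMeasurable f μ)
    (hrow : ∀ x, ∫⁻ y, k x y ∂μ ≤ A) (hcol : ∀ y, ∫⁻ x, k x y ∂μ ≤ A)
    (hsup : ∀ x y, k x y ≤ A * S) (htot : ∫⁻ x, ∫⁻ y, k x y ∂μ ∂μ ≤ A * S)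
    {p q : ℝ≥0∞} (hp : 1 ≤ p) (hq : 1 ≤ q) :
    eLpNorm (fun x => ∫⁻ y, k x y * f y ∂μ) q μ ≤
      A * S ^ |p.toReal⁻¹ - q.toReal⁻¹| * eLpNorm f p μ := by
  have hkx : ∀ x, Measurable (k x) := fun x => hk.comp (measurable_const.prodMk measurable_id)
  have hrm : Measurable fun x => ∫⁻ y, k x y ∂μ := hk.lintegral_prod_right'
  have hApow : ∀ r : ℝ, 0 ≤ r → A ^ r * A = A ^ (r + 1) := fun r hr => by
    rw [ENNReal.rpow_add_of_nonneg _ _ hr zero_le_one, ENNReal.rpow_one]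
  by_cases hp' : p = ∞
  · subst hp'
    have h1 : ∀ x, ∫⁻ y, k x y * f y ∂μ ≤ (∫⁻ y, k x y ∂μ) * eLpNorm f ∞ μ := by
      intro x
      rw [← lintegral_mul_const _ (hkx x)]
      refine lintegral_mono_ae ?_
      rw [eLpNorm_exponent_top]
      filter_upwards [enorm_ae_le_eLpNormEssSup f μ] with y hy
      gcongr
      exact hy
    by_cases hq' : q = ∞
    · subst hq'
      simp only [ENNReal.toReal_top, inv_zero, sub_self, abs_zero, ENNReal.rpow_zero, mul_one]
      rw [eLpNorm_exponent_top]
      refine essSup_le_of_ae_le _ (Filter.Eventually.of_forall fun x => ?_)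
      exact (h1 x).trans (by exact mul_le_mul_left (hrow x) _)
    · have hq1 : 1 ≤ q.toReal := by
        simpa using (ENNReal.toReal_le_toReal ENNReal.one_ne_top hq').2 hq
      have hq0 : 0 < q.toReal := by linarith
      refine eLpNorm_le_of_lintegral_rpow_le hq hq' ?_
      calc ∫⁻ x, (∫⁻ y, k x y * f y ∂μ) ^ q.toReal ∂μ
          ≤ ∫⁻ x, A ^ (q.toReal - 1) * (∫⁻ y, k x y ∂μ) * eLpNorm f ∞ μ ^ q.toReal ∂μ := by
            refine lintegral_mono fun x => ?_
            calc (∫⁻ y, k x y * f y ∂μ) ^ q.toReal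
                ≤ ((∫⁻ y, k x y ∂μ) * eLpNorm f ∞ μ) ^ q.toReal := by gcongr; exact h1 x
              _ = (∫⁻ y, k x y ∂μ) ^ ((q.toReal - 1) + 1) * eLpNorm f ∞ μ ^ q.toReal := by
                rw [ENNReal.mul_rpow_of_nonneg _ _ hq0.le, sub_add_cancel]
              _ ≤ _ := by
                rw [ENNReal.rpow_add_of_nonneg _ _ (by linarith) zero_le_one, ENNReal.rpow_one]
                gcongr
                exact hrow x
        _ = A ^ (q.toReal - 1) * (∫⁻ x, ∫⁻ y, k x y ∂μ ∂μ) * eLpNorm f ∞ μ ^ q.toReal := by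
            rw [lintegral_mul_const _ (hrm.const_mul _), lintegral_const_mul _ hrm]
        _ ≤ A ^ (q.toReal - 1) * (A * S) * eLpNorm f ∞ μ ^ q.toReal := by gcongr
        _ = _ := by
            rw [← mul_assoc, hApow _ (by linarith), ENNReal.mul_rpow_of_nonneg _ _ hq0.le,
              ENNReal.mul_rpow_of_nonneg _ _ hq0.le, ← ENNReal.rpow_mul]
            simp only [ENNReal.toReal_top, inv_zero, zero_sub, abs_neg, abs_inv,
              abs_of_pos hq0, inv_mul_cancel₀ hq0.ne', sub_add_cancel, ENNReal.rpow_one]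
  have hp1 : 1 ≤ p.toReal := by
    simpa using (ENNReal.toReal_le_toReal ENNReal.one_ne_top hp').2 hp
  have hp0 : 0 < p.toReal := by linarith
  have hpi : p.toReal⁻¹ ≤ 1 := inv_le_one_of_one_le₀ hp1
  set F := eLpNorm f p μ with hF
  have hFp : ∫⁻ y, f y ^ p.toReal ∂μ = F ^ p.toReal := lintegral_rpow_eq_eLpNorm_rpow hp hp'
  -- By Jensen the operator is controlled by the row integral and `H`; `hsup` bounds `H` uniformly
  -- and `hcol` bounds its integral.
  set H : α → ℝ≥0∞ := fun x => ∫⁻ y, k x y * f y ^ p.toReal ∂μ with hH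
  have hHm : AEMeasurable H μ :=
    (hk.aemeasurable.mul (hf.pow_const p.toReal).comp_snd).lintegral_prod_right'
  have hHsup : ∀ x, H x ≤ A * S * F ^ p.toReal := fun x => by
    rw [← hFp, ← lintegral_const_mul'' _ (hf.pow_const _)]
    exact lintegral_mono fun y => by gcongr; exact hsup x y
  have hHint : ∫⁻ x, H x ∂μ ≤ A * F ^ p.toReal := by
    rw [← hFp]
    exact lintegral_lintegral_mul_le hk (hf.pow_const _) hcol
  have hJ : ∀ x, ∫⁻ y, k x y * f y ∂μ ≤
      (∫⁻ y, k x y ∂μ) ^ (1 - p.toReal⁻¹) * H x ^ p.toReal⁻¹ := by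
    intro x
    have h := lintegral_mul_rpow_le (hkx x).aemeasurable hf hp1
    rw [← ENNReal.le_rpow_inv_iff hp0, ENNReal.mul_rpow_of_nonneg _ _ (inv_nonneg.2 hp0.le),
      ← ENNReal.rpow_mul] at h
    refine h.trans_eq ?_
    congr 2
    field_simp
  by_cases hq' : q = ∞
  · subst hq'
    simp only [ENNReal.toReal_top, inv_zero, sub_zero, abs_inv, abs_of_pos hp0]
    rw [eLpNorm_exponent_top]
    refine essSup_le_of_ae_le _ (Filter.Eventually.of_forall fun x => ?_)
    calc (∫⁻ y, k x y * f y ∂μ)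
        ≤ (∫⁻ y, k x y ∂μ) ^ (1 - p.toReal⁻¹) * H x ^ p.toReal⁻¹ := hJ x
      _ ≤ A ^ (1 - p.toReal⁻¹) * (A * S * F ^ p.toReal) ^ p.toReal⁻¹ := by
          gcongr
          exacts [hrow x, hHsup x]
      _ = _ := by
          rw [ENNReal.mul_rpow_of_nonneg _ _ (inv_nonneg.2 hp0.le),
            ENNReal.mul_rpow_of_nonneg _ _ (inv_nonneg.2 hp0.le), ENNReal.rpow_rpow_inv hp0.ne',
            ← mul_assoc, ← mul_assoc,
            ← ENNReal.rpow_add_of_nonneg _ _ (by linarith) (inv_nonneg.2 hp0.le)]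
          simp
  have hq1 : 1 ≤ q.toReal := by
    simpa using (ENNReal.toReal_le_toReal ENNReal.one_ne_top hq').2 hq
  have hq0 : 0 < q.toReal := by linarith
  refine eLpNorm_le_of_lintegral_rpow_le hq hq' ?_
  generalize p.toReal = p at *
  generalize q.toReal = q at *
  have hJq : ∀ x, (∫⁻ y, k x y * f y ∂μ) ^ q ≤
      (∫⁻ y, k x y ∂μ) ^ (q - q / p) * H x ^ (q / p) := by
    intro x
    calc (∫⁻ y, k x y * f y ∂μ) ^ q
        ≤ ((∫⁻ y, k x y ∂μ) ^ (1 - p⁻¹) * H x ^ p⁻¹) ^ q := by gcongr; exact hJ x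
      _ = _ := by
          rw [ENNReal.mul_rpow_of_nonneg _ _ hq0.le, ← ENNReal.rpow_mul, ← ENNReal.rpow_mul]
          congr 2 <;> field_simp
  have hqp0 : 0 ≤ q / p := by positivity
  have hqqp : 0 ≤ q - q / p := by
    rw [div_eq_mul_inv]; nlinarith
  rcases le_total p q with hpq | hpq
  -- For `p ≤ q`, the surplus power `q/p - 1` of `H` is estimated by its supremum, and one power is
  -- integrated.
  · have hqp1 : 1 ≤ q / p := (one_le_div hp0).2 hpq
    have hab : |p⁻¹ - q⁻¹| * q = q / p - 1 := by
      rw [abs_of_nonneg (sub_nonneg.2 (inv_anti₀ hp0 hpq))]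
      field_simp
    calc ∫⁻ x, (∫⁻ y, k x y * f y ∂μ) ^ q ∂μ
        ≤ ∫⁻ x, A ^ (q - q / p) * (A * S * F ^ p) ^ (q / p - 1) * H x ∂μ := by
          refine lintegral_mono fun x => (hJq x).trans ?_
          have : H x ^ (q / p) = H x ^ (q / p - 1) * H x := by
            nth_rw 3 [← ENNReal.rpow_one (H x)]
            rw [← ENNReal.rpow_add_of_nonneg _ _ (by linarith) zero_le_one, sub_add_cancel]
          rw [this, ← mul_assoc]
          gcongr
          exacts [hrow x, hHsup x]
      _ ≤ A ^ (q - q / p) * (A * S * F ^ p) ^ (q / p - 1) * (A * F ^ p) := by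
          rw [lintegral_const_mul'' _ hHm]
          gcongr
      _ = _ := by
          rw [ENNReal.mul_rpow_of_nonneg _ _ (by linarith : 0 ≤ q / p - 1),
            ENNReal.mul_rpow_of_nonneg _ _ (by linarith : 0 ≤ q / p - 1),
            ENNReal.mul_rpow_of_nonneg _ _ hq0.le, ENNReal.mul_rpow_of_nonneg _ _ hq0.le,
            ← ENNReal.rpow_mul S, hab, ← ENNReal.rpow_mul F]
          calc A ^ (q - q / p) * (A ^ (q / p - 1) * S ^ (q / p - 1) * F ^ (p * (q / p - 1))) *
                (A * F ^ p)
              = (A ^ (q - q / p) * A ^ (q / p - 1) * A) * S ^ (q / p - 1) *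
                (F ^ (p * (q / p - 1)) * F ^ p) := by ring
            _ = _ := by
              rw [← ENNReal.rpow_add_of_nonneg _ _ hqqp (by linarith), hApow _ (by linarith),
                ← ENNReal.rpow_add_of_nonneg _ _ (mul_nonneg hp0.le (by linarith)) hp0.le]
              congr 2
              · congr 2; ring
              · field_simp; ring
  -- For `q ≤ p`, Hölder in `x` distributes the integral between the row integral, controlled by
  -- `htot`, and `H`.
  · have hqp1 : q / p ≤ 1 := (div_le_one hp0).2 hpq
    have hab : |p⁻¹ - q⁻¹| * q = 1 - q / p := by
      rw [abs_sub_comm, abs_of_nonneg (sub_nonneg.2 (inv_anti₀ hq0 hpq))]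
      field_simp
    calc ∫⁻ x, (∫⁻ y, k x y * f y ∂μ) ^ q ∂μ
        ≤ ∫⁻ x, A ^ (q - 1) * ((∫⁻ y, k x y ∂μ) ^ (1 - q / p) * H x ^ (q / p)) ∂μ := by
          refine lintegral_mono fun x => (hJq x).trans ?_
          rw [show q - q / p = (q - 1) + (1 - q / p) by ring,
            ENNReal.rpow_add_of_nonneg _ _ (by linarith) (by linarith), mul_assoc]
          gcongr
          exact hrow x
      _ = A ^ (q - 1) * ∫⁻ x, (∫⁻ y, k x y ∂μ) ^ (1 - q / p) * H x ^ (q / p) ∂μ :=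
          lintegral_const_mul'' _ ((hrm.pow_const _).aemeasurable.mul (hHm.pow_const _))
      _ ≤ A ^ (q - 1) * ((∫⁻ x, ∫⁻ y, k x y ∂μ ∂μ) ^ (1 - q / p) *
            (∫⁻ x, H x ∂μ) ^ (q / p)) := by
          gcongr
          exact ENNReal.lintegral_mul_norm_pow_le hrm.aemeasurable hHm (by linarith) hqp0 (by ring)
      _ ≤ A ^ (q - 1) * ((A * S) ^ (1 - q / p) * (A * F ^ p) ^ (q / p)) := by
          gcongr
      _ = _ := by
          rw [ENNReal.mul_rpow_of_nonneg _ _ (by linarith : 0 ≤ 1 - q / p),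
            ENNReal.mul_rpow_of_nonneg _ _ hqp0,
            ENNReal.mul_rpow_of_nonneg _ _ hq0.le, ENNReal.mul_rpow_of_nonneg _ _ hq0.le,
            ← ENNReal.rpow_mul S, hab, ← ENNReal.rpow_mul F]
          calc A ^ (q - 1) * (A ^ (1 - q / p) * S ^ (1 - q / p) * (A ^ (q / p) * F ^ (p * (q / p))))
              = (A ^ (q - 1) * (A ^ (1 - q / p) * A ^ (q / p))) * S ^ (1 - q / p) *
                F ^ (p * (q / p)) := by ring
            _ = _ := by
              rw [← ENNReal.rpow_add_of_nonneg _ _ (by linarith : 0 ≤ 1 - q / p) hqp0,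
                ← ENNReal.rpow_add_of_nonneg _ _ (by linarith) (by linarith)]
              congr 2
              · congr 1; ring
              · field_simp

end Abstract

/-! ### Gaussian integrals and mixed-norm bounds for the heat kernel -/

section HeatKernel

variable {d : ℕ}

/-- A single lower bound that records both the linear behaviour at `0` and exponential growth at
infinity, so that no later upper bound has to split the range of `t`. -/
theorem self_mul_exp_le_sinh_two_mul {t : ℝ} (ht : 0 < t) :
    t * Real.exp t ≤ Real.sinh (2 * t) := by
  have h1 : t ≤ Real.sinh t := Real.self_le_sinh_iff.2 ht.le
  have h2 : Real.exp t / 2 ≤ Real.cosh t := by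
    rw [Real.cosh_eq]
    have := Real.exp_pos (-t)
    linarith
  rw [Real.sinh_two_mul]
  have := mul_le_mul h1 h2 (by positivity) (ht.le.trans h1)
  linarith

theorem sinh_le_self_mul_cosh {t : ℝ} (ht : 0 < t) : Real.sinh t ≤ t * Real.cosh t := by
  obtain ⟨c, hc, h⟩ := exists_hasDerivAt_eq_slope Real.sinh Real.cosh ht
    Real.continuous_sinh.continuousOn fun x _ => Real.hasDerivAt_sinh x
  rw [Real.sinh_zero, sub_zero, sub_zero, eq_div_iff ht.ne'] at h
  have : Real.cosh c ≤ Real.cosh t := by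
    rw [Real.cosh_le_cosh, abs_of_pos hc.1, abs_of_pos ht]
    exact hc.2.le
  nlinarith

theorem half_dim_pos (hd : 1 ≤ d) : 0 < (d : ℝ) / 2 := by
  have : (1 : ℝ) ≤ d := by exact_mod_cast hd
  positivity

theorem sinh_two_mul_le {t : ℝ} (ht : 0 < t) (ht1 : t ≤ 1) :
    Real.sinh (2 * t) ≤ 2 * Real.cosh 2 * t := by
  have h1 := sinh_le_self_mul_cosh (by linarith : 0 < 2 * t)
  have h2 : Real.cosh (2 * t) ≤ Real.cosh 2 := by
    rw [Real.cosh_le_cosh, abs_of_pos (by linarith), abs_of_pos two_pos]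
    linarith
  nlinarith

theorem sinh_two_mul_pos {t : ℝ} (ht : 0 < t) : 0 < Real.sinh (2 * t) :=
  Real.sinh_pos_iff.2 (by linarith)

theorem tanh_pos {t : ℝ} (ht : 0 < t) : 0 < Real.tanh t := by
  rw [Real.tanh_eq_sinh_div_cosh]
  exact div_pos (Real.sinh_pos_iff.2 ht) (Real.cosh_pos _)

theorem two_pi_mul_sinh_pos {t : ℝ} (ht : 0 < t) : 0 < 2 * Real.pi * Real.sinh (2 * t) :=
  mul_pos (by positivity) (sinh_two_mul_pos ht)

theorem heatKernel_nonneg {t : ℝ} (ht : 0 < t) (x y : EuclideanSpace ℝ (Fin d)) :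
    0 ≤ heatKernel d t x y :=
  mul_nonneg (Real.rpow_nonneg (two_pi_mul_sinh_pos ht).le _) (Real.exp_pos _).le

theorem heatKernel_comm (t : ℝ) (x y : EuclideanSpace ℝ (Fin d)) :
    heatKernel d t x y = heatKernel d t y x := by
  rw [heatKernel, heatKernel, add_comm x y, norm_sub_rev x y]

theorem measurable_tanh : Measurable Real.tanh := by
  have : Real.tanh = fun t => Real.sinh t / Real.cosh t :=
    funext Real.tanh_eq_sinh_div_cosh
  rw [this]
  exact Real.measurable_sinh.div Real.measurable_cosh

@[fun_prop]
theorem measurable_heatKernel {γ : Type*} [MeasurableSpace γ] {a : γ → ℝ}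
    {b c : γ → EuclideanSpace ℝ (Fin d)} (ha : Measurable a) (hb : Measurable b)
    (hc : Measurable c) : Measurable fun z => heatKernel d (a z) (b z) (c z) := by
  unfold heatKernel
  have h : Measurable fun z => Real.tanh (a z) := measurable_tanh.comp ha
  fun_prop

/-- Completing the square in `y` turns the row integral into a translated Gaussian integral and
isolates the decay in `x`. -/
theorem heatKernel_eq {t : ℝ} (ht : 0 < t) (x y : EuclideanSpace ℝ (Fin d)) :
    heatKernel d t x y = (2 * Real.pi * Real.sinh (2 * t)) ^ (-((d : ℝ) / 2)) *
      Real.exp (-(Real.tanh (2 * t) / 2) * ‖x‖ ^ 2) *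
      Real.exp (-(2 * Real.tanh (2 * t))⁻¹ * ‖y - (Real.cosh (2 * t))⁻¹ • x‖ ^ 2) := by
  rw [heatKernel, mul_assoc (_ ^ _), ← Real.exp_add]
  congr 2
  rw [norm_add_sq_real, norm_sub_sq_real, norm_sub_sq_real, norm_smul, real_inner_smul_right,
    real_inner_comm y x, mul_pow, Real.norm_eq_abs, sq_abs, Real.tanh_eq_sinh_div_cosh,
    Real.tanh_eq_sinh_div_cosh, Real.sinh_two_mul, Real.cosh_two_mul]
  have hs := Real.sinh_pos_iff.2 ht
  have hc := Real.cosh_pos t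
  have h := Real.cosh_sq t
  set s := Real.sinh t
  set c := Real.cosh t
  have hcs : 0 < c ^ 2 + s ^ 2 := by positivity
  have e1 : s / c + c / s = (c ^ 2 + s ^ 2) / (s * c) := by field_simp; ring
  have e2 : s / c - c / s = -1 / (s * c) := by
    field_simp
    linarith
  -- Twice the identity `coth 2t = tanh 2t + 1 / (sinh 2t · cosh 2t)`.
  have e3 : (c ^ 2 + s ^ 2) / (s * c) =
      4 * s * c / (c ^ 2 + s ^ 2) + 1 / (s * c * (c ^ 2 + s ^ 2)) := by
    have : (c ^ 2 + s ^ 2) ^ 2 = (2 * s * c) ^ 2 + 1 := by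
      rw [h]; ring_nf; rw [h]; ring
    field_simp
    linarith
  generalize inner ℝ y x = i
  calc -(1 / 4) * (s / c * (‖x‖ ^ 2 + 2 * i + ‖y‖ ^ 2) + c / s * (‖x‖ ^ 2 - 2 * i + ‖y‖ ^ 2))
      = -(1 / 4) * ((s / c + c / s) * ‖x‖ ^ 2 + (s / c + c / s) * ‖y‖ ^ 2
          + 2 * (s / c - c / s) * i) := by ring
    _ = -(1 / 4) * ((4 * s * c / (c ^ 2 + s ^ 2) + 1 / (s * c * (c ^ 2 + s ^ 2))) * ‖x‖ ^ 2
          + ((c ^ 2 + s ^ 2) / (s * c)) * ‖y‖ ^ 2 + 2 * (-1 / (s * c)) * i) := by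
        rw [e1, e2, ← e3]
    _ = _ := by
        field_simp
        ring

theorem lintegral_exp_neg_mul_sq_norm {b : ℝ} (hb : 0 < b) (a : EuclideanSpace ℝ (Fin d)) :
    ∫⁻ y : EuclideanSpace ℝ (Fin d), ENNReal.ofReal (Real.exp (-b * ‖y - a‖ ^ 2)) =
      ENNReal.ofReal ((Real.pi / b) ^ ((d : ℝ) / 2)) := by
  have h := GaussianFourier.integral_rexp_neg_mul_sq_norm (V := EuclideanSpace ℝ (Fin d)) hb
  rw [finrank_euclideanSpace_fin] at h
  have hne : (Real.pi / b) ^ ((d : ℝ) / 2) ≠ 0 := by positivity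
  rw [lintegral_sub_right_eq_self (fun y : EuclideanSpace ℝ (Fin d) =>
    ENNReal.ofReal (Real.exp (-b * ‖y‖ ^ 2))) a, ← h, ofReal_integral_eq_lintegral_ofReal]
  -- A Bochner integral with nonzero value forces integrability, since the default value is `0`.
  · exact not_imp_comm.1 integral_undef (h ▸ hne)
  · exact Filter.Eventually.of_forall fun y => (Real.exp_pos _).le

theorem lintegral_heatKernel {t : ℝ} (ht : 0 < t) (x : EuclideanSpace ℝ (Fin d)) :
    ∫⁻ y, ENNReal.ofReal (heatKernel d t x y) =
      ENNReal.ofReal (Real.cosh (2 * t) ^ (-((d : ℝ) / 2)) *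
        Real.exp (-(Real.tanh (2 * t) / 2) * ‖x‖ ^ 2)) := by
  have hs := sinh_two_mul_pos ht
  have hc := Real.cosh_pos (2 * t)
  have hT : 0 < Real.tanh (2 * t) := tanh_pos (by linarith)
  have h0 := Real.rpow_nonneg (two_pi_mul_sinh_pos ht).le (-((d : ℝ) / 2))
  simp only [heatKernel_eq ht]
  simp_rw [ENNReal.ofReal_mul (mul_nonneg h0 (Real.exp_pos _).le)]
  rw [lintegral_const_mul _ (by fun_prop), lintegral_exp_neg_mul_sq_norm (by positivity),
    ← ENNReal.ofReal_mul (mul_nonneg h0 (Real.exp_pos _).le)]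
  congr 1
  rw [mul_right_comm]
  congr 1
  rw [Real.rpow_neg (two_pi_mul_sinh_pos ht).le, ← Real.inv_rpow (two_pi_mul_sinh_pos ht).le,
    ← Real.mul_rpow (by positivity) (by positivity), Real.rpow_neg hc.le, ← Real.inv_rpow hc.le,
    Real.tanh_eq_sinh_div_cosh]
  congr 1
  field_simp

theorem lintegral_lintegral_heatKernel {t : ℝ} (ht : 0 < t) :
    ∫⁻ x, ∫⁻ y, ENNReal.ofReal (heatKernel d t x y) =
      ENNReal.ofReal ((2 * Real.pi) ^ ((d : ℝ) / 2) * Real.sinh (2 * t) ^ (-((d : ℝ) / 2))) := by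
  have hs := sinh_two_mul_pos ht
  have hc := Real.cosh_pos (2 * t)
  have hT : 0 < Real.tanh (2 * t) := tanh_pos (by linarith)
  simp only [lintegral_heatKernel ht]
  simp_rw [ENNReal.ofReal_mul (Real.rpow_nonneg hc.le (-((d : ℝ) / 2)))]
  have h := lintegral_exp_neg_mul_sq_norm (half_pos hT) (0 : EuclideanSpace ℝ (Fin d))
  simp only [sub_zero] at h
  rw [lintegral_const_mul _ (by fun_prop), h,
    ← ENNReal.ofReal_mul (Real.rpow_nonneg hc.le _)]
  congr 1
  rw [Real.rpow_neg hc.le, ← Real.inv_rpow hc.le, Real.rpow_neg hs.le, ← Real.inv_rpow hs.le,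
    ← Real.mul_rpow (by positivity) (by positivity),
    ← Real.mul_rpow (by positivity) (by positivity), Real.tanh_eq_sinh_div_cosh]
  congr 1
  field_simp

theorem sinh_rpow_neg_le {t : ℝ} (ht : 0 < t) :
    Real.sinh (2 * t) ^ (-((d : ℝ) / 2)) ≤
      Real.exp (-((d : ℝ) / 2) * t) * t ^ (-((d : ℝ) / 2)) := by
  have h := Real.rpow_le_rpow_of_nonpos (by positivity) (self_mul_exp_le_sinh_two_mul ht)
    (neg_nonpos.2 (by positivity : 0 ≤ (d : ℝ) / 2))
  refine h.trans_eq ?_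
  rw [Real.mul_rpow ht.le (Real.exp_pos _).le, ← Real.exp_mul, mul_comm, mul_comm t]

theorem one_le_two_pi_rpow : 1 ≤ (2 * Real.pi) ^ ((d : ℝ) / 2) :=
  Real.one_le_rpow (by linarith [Real.pi_gt_three]) (by positivity)

theorem heatKernel_le {t : ℝ} (ht : 0 < t) (x y : EuclideanSpace ℝ (Fin d)) :
    heatKernel d t x y ≤ Real.exp (-((d : ℝ) / 2) * t) * t ^ (-((d : ℝ) / 2)) *
      Real.exp (-(4 * t)⁻¹ * ‖x - y‖ ^ 2) := by
  rw [heatKernel]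
  have hs := sinh_two_mul_pos ht
  refine mul_le_mul ((Real.rpow_le_rpow_of_nonpos hs ?_
    (neg_nonpos.2 (by positivity : 0 ≤ (d : ℝ) / 2))).trans (sinh_rpow_neg_le ht)) ?_
    (Real.exp_pos _).le (by positivity)
  · nlinarith [Real.pi_gt_three]
  · rw [Real.exp_le_exp]
    have h1 : t⁻¹ ≤ Real.cosh t / Real.sinh t := by
      rw [inv_eq_one_div, div_le_div_iff₀ ht (Real.sinh_pos_iff.2 ht)]
      linarith [sinh_le_self_mul_cosh ht]
    have h2 := mul_le_mul_of_nonneg_right h1 (sq_nonneg ‖x - y‖)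
    have h3 := mul_nonneg (tanh_pos ht).le (sq_nonneg ‖x + y‖)
    rw [mul_inv]
    nlinarith

/-- The common bound for the row and column integrals of `heatKernel d t`. -/
noncomputable def rowBound (d : ℕ) (t : ℝ) : ℝ := (2 * Real.pi) ^ ((d : ℝ) / 2) * Real.exp (-((d : ℝ) / 2) * t)

theorem rowBound_pos (t : ℝ) : 0 < rowBound d t := by
  unfold rowBound
  positivity

/-- The factor `(2π)^(d/2)` in `rowBound` exceeds what row integrals need; it comes from the total
mass, and keeping it lets one constant serve for all the hypotheses of `eLpNorm_kernel_le`. -/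
theorem cosh_rpow_neg_le {t : ℝ} (ht : 0 < t) :
    Real.cosh (2 * t) ^ (-((d : ℝ) / 2)) ≤ rowBound d t := by
  have h1 : (2 * Real.pi)⁻¹ * Real.exp t ≤ Real.cosh (2 * t) := by
    have h2 : (2 * Real.pi)⁻¹ ≤ 2⁻¹ :=
      inv_anti₀ two_pos (by linarith [Real.pi_gt_three])
    have h3 : Real.exp t ≤ Real.exp (2 * t) := Real.exp_le_exp.2 (by linarith)
    rw [Real.cosh_eq]
    have := mul_le_mul h2 h3 (Real.exp_pos _).le (by norm_num)
    linarith [Real.exp_pos (-(2 * t))]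
  have h := Real.rpow_le_rpow_of_nonpos (by positivity) h1
    (neg_nonpos.2 (by positivity : 0 ≤ (d : ℝ) / 2))
  refine h.trans_eq ?_
  rw [Real.mul_rpow (by positivity) (Real.exp_pos _).le, ← Real.exp_mul, rowBound,
    Real.inv_rpow (by positivity), Real.rpow_neg (by positivity), inv_inv, mul_comm t]

theorem lintegral_heatKernel_le {t : ℝ} (ht : 0 < t) (x : EuclideanSpace ℝ (Fin d)) :
    ∫⁻ y, ENNReal.ofReal (heatKernel d t x y) ≤
      ENNReal.ofReal (rowBound d t * Real.exp (-(Real.tanh (2 * t) / 2) * ‖x‖ ^ 2)) := by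
  rw [lintegral_heatKernel ht]
  gcongr
  exact cosh_rpow_neg_le ht

/-- This is `eLpNorm_kernel_le` with `A = rowBound d t` and `S = t^(-d/2)`; symmetry of the kernel
turns the row bound into the column bound. -/
theorem eLpNorm_heatKernel_le {t : ℝ} (ht : 0 < t) {f : EuclideanSpace ℝ (Fin d) → ℝ≥0∞}
    (hf : AEMeasurable f) {p q : ℝ≥0∞} (hp : 1 ≤ p) (hq : 1 ≤ q) :
    eLpNorm (fun x => ∫⁻ y, ENNReal.ofReal (heatKernel d t x y) * f y) q volume ≤
      ENNReal.ofReal (rowBound d t * (t ^ (-((d : ℝ) / 2))) ^ |p.toReal⁻¹ - q.toReal⁻¹|) *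
        eLpNorm f p volume := by
  have hS : 0 < t ^ (-((d : ℝ) / 2)) := Real.rpow_pos_of_pos ht _
  have hrow : ∀ x : EuclideanSpace ℝ (Fin d), ∫⁻ y, ENNReal.ofReal (heatKernel d t x y) ≤
      ENNReal.ofReal (rowBound d t) := fun x => by
    refine (lintegral_heatKernel_le ht x).trans (ENNReal.ofReal_le_ofReal ?_)
    refine mul_le_of_le_one_right (rowBound_pos t).le (Real.exp_le_one_iff.2 ?_)
    have hT : 0 < Real.tanh (2 * t) := tanh_pos (by linarith)
    have := mul_nonneg (half_pos hT).le (sq_nonneg ‖x‖)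
    linarith
  have hm : Measurable (Function.uncurry fun x y : EuclideanSpace ℝ (Fin d) =>
      ENNReal.ofReal (heatKernel d t x y)) :=
    (measurable_heatKernel measurable_const measurable_fst measurable_snd).ennreal_ofReal
  rw [ENNReal.ofReal_mul (rowBound_pos t).le,
    ← ENNReal.ofReal_rpow_of_nonneg hS.le (abs_nonneg _)]
  refine eLpNorm_kernel_le hm hf hrow (fun y => ?_) (fun x y => ?_) ?_ hp hq
  · simp only [fun x => heatKernel_comm t x y]
    exact hrow y
  · rw [← ENNReal.ofReal_mul (rowBound_pos t).le]
    refine ENNReal.ofReal_le_ofReal ((heatKernel_le ht x y).trans ?_)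
    rw [rowBound]
    have h1 : Real.exp (-(4 * t)⁻¹ * ‖x - y‖ ^ 2) ≤ 1 := by
      rw [Real.exp_le_one_iff, neg_mul]
      exact neg_nonpos.2 (by positivity)
    calc _ ≤ Real.exp (-((d : ℝ) / 2) * t) * t ^ (-((d : ℝ) / 2)) :=
          mul_le_of_le_one_right (by positivity) h1
      _ ≤ _ := by
          rw [mul_assoc]
          exact le_mul_of_one_le_left (by positivity) one_le_two_pi_rpow
  · rw [← ENNReal.ofReal_mul (rowBound_pos t).le, lintegral_lintegral_heatKernel ht, rowBound,
      mul_assoc]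
    gcongr
    exact sinh_rpow_neg_le ht

end HeatKernel

/-! ### The potential operator away from the singular pairs -/

section Potential

variable {d : ℕ}

/-- The powers of `t` combine to `t⁻¹` in every dimension; off the diagonal the Gaussian factor
absorbs it, and `e^(-dt/2)` handles large `t`. -/
theorem integrableOn_heatKernel_mul_rpow (hd : 1 ≤ d) {x y : EuclideanSpace ℝ (Fin d)}
    (hxy : x ≠ y) :
    IntegrableOn (fun t : ℝ => heatKernel d t x y * t ^ ((d : ℝ) / 2 - 1)) (Set.Ioi 0) := by
  have hσ := half_dim_pos hd
  set δ : ℝ := ‖x - y‖ ^ 2 / 4 with hδ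
  have hδ0 : 0 < δ := by
    have := norm_pos_iff.2 (sub_ne_zero.2 hxy)
    positivity
  refine Integrable.mono' ((exp_neg_integrableOn_Ioi 0 hσ).const_mul δ⁻¹)
    (Measurable.aestronglyMeasurable (by fun_prop)) ?_
  refine (ae_restrict_mem measurableSet_Ioi).mono fun t (ht : 0 < t) => ?_
  rw [Real.norm_eq_abs, abs_of_nonneg (mul_nonneg (heatKernel_nonneg ht x y)
    (Real.rpow_nonneg ht.le _))]
  -- From `s ≤ e^s` at `s = δ / t`.
  have h1 : t⁻¹ * Real.exp (-(4 * t)⁻¹ * ‖x - y‖ ^ 2) ≤ δ⁻¹ := by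
    have h2 : δ / t ≤ Real.exp (δ / t) := by linarith [Real.add_one_le_exp (δ / t)]
    have h3 : -(4 * t)⁻¹ * ‖x - y‖ ^ 2 = -(δ / t) := by rw [hδ]; field_simp
    rw [h3, Real.exp_neg]
    calc t⁻¹ * (Real.exp (δ / t))⁻¹ ≤ t⁻¹ * (δ / t)⁻¹ := by gcongr
      _ = δ⁻¹ := by field_simp
  calc heatKernel d t x y * t ^ ((d : ℝ) / 2 - 1)
      ≤ (Real.exp (-((d : ℝ) / 2) * t) * t ^ (-((d : ℝ) / 2)) *
          Real.exp (-(4 * t)⁻¹ * ‖x - y‖ ^ 2)) * t ^ ((d : ℝ) / 2 - 1) := by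
        gcongr
        exact heatKernel_le ht x y
    _ = (t ^ (-((d : ℝ) / 2)) * t ^ ((d : ℝ) / 2 - 1)) * Real.exp (-(4 * t)⁻¹ * ‖x - y‖ ^ 2) *
          Real.exp (-((d : ℝ) / 2) * t) := by ring
    _ = t⁻¹ * Real.exp (-(4 * t)⁻¹ * ‖x - y‖ ^ 2) * Real.exp (-((d : ℝ) / 2) * t) := by
        rw [← Real.rpow_add ht, show -((d : ℝ) / 2) + ((d : ℝ) / 2 - 1) = -1 by ring,
          Real.rpow_neg_one]
    _ ≤ _ := by gcongr

theorem potentialKernel_nonneg {σ : ℝ} (hσ : 0 < σ) (x y : EuclideanSpace ℝ (Fin d)) :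
    0 ≤ potentialKernel d σ x y :=
  mul_nonneg (inv_nonneg.2 (Real.Gamma_pos_of_pos hσ).le)
    (setIntegral_nonneg measurableSet_Ioi fun _ ht =>
      mul_nonneg (heatKernel_nonneg ht x y) (Real.rpow_nonneg (le_of_lt ht) _))

theorem stronglyMeasurable_potentialKernel (σ : ℝ) :
    StronglyMeasurable fun z : EuclideanSpace ℝ (Fin d) × EuclideanSpace ℝ (Fin d) =>
      potentialKernel d σ z.1 z.2 := by
  have h : Measurable fun z : ℝ × EuclideanSpace ℝ (Fin d) × EuclideanSpace ℝ (Fin d) =>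
      heatKernel d z.1 z.2.1 z.2.2 * z.1 ^ (σ - 1) := by fun_prop
  exact (h.stronglyMeasurable.integral_prod_left'
    (μ := volume.restrict (Set.Ioi (0 : ℝ)))).const_mul _

theorem aestronglyMeasurable_potentialOperator {𝕜 : Type*} [RCLike 𝕜] (σ : ℝ)
    {f : EuclideanSpace ℝ (Fin d) → 𝕜} (hf : AEStronglyMeasurable f) :
    AEStronglyMeasurable (potentialOperator d σ f) :=
  ((stronglyMeasurable_potentialKernel σ).aestronglyMeasurable.smul
    (hf.comp_snd (μ := volume))).integral_prod_right'

/-- The integral operator with kernel `|K^σ|`, acting on `ℝ≥0∞`-valued functions. -/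
noncomputable def potentialMajorant (d : ℕ) (σ : ℝ) (F : EuclideanSpace ℝ (Fin d) → ℝ≥0∞)
    (x : EuclideanSpace ℝ (Fin d)) : ℝ≥0∞ :=
  ∫⁻ y, ‖potentialKernel d σ x y‖ₑ * F y

theorem enorm_potentialOperator_le {𝕜 : Type*} [RCLike 𝕜] (σ : ℝ)
    (f : EuclideanSpace ℝ (Fin d) → 𝕜) (x : EuclideanSpace ℝ (Fin d)) :
    ‖potentialOperator d σ f x‖ₑ ≤ potentialMajorant d σ (fun y => ‖f y‖ₑ) x := by
  refine (enorm_integral_le_lintegral_enorm _).trans_eq ?_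
  simp only [enorm_smul, potentialMajorant]

/-- As an inequality this survives on the diagonal, where the kernel may take a default value; the
equality below needs `x ≠ y`. -/
theorem enorm_potentialKernel_le {σ : ℝ} (hσ : 0 < σ) (x y : EuclideanSpace ℝ (Fin d)) :
    ‖potentialKernel d σ x y‖ₑ ≤ ∫⁻ t in Set.Ioi (0 : ℝ),
      ENNReal.ofReal ((Real.Gamma σ)⁻¹ * t ^ (σ - 1)) * ENNReal.ofReal (heatKernel d t x y) := by
  have hΓ := inv_nonneg.2 (Real.Gamma_pos_of_pos hσ).le
  rw [potentialKernel, ← integral_const_mul]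
  refine (enorm_integral_le_lintegral_enorm _).trans_eq ?_
  refine setLIntegral_congr_fun measurableSet_Ioi fun t (ht : 0 < t) => ?_
  have h := Real.rpow_nonneg ht.le (σ - 1)
  rw [Real.enorm_eq_ofReal (mul_nonneg hΓ (mul_nonneg (heatKernel_nonneg ht x y) h)),
    ← ENNReal.ofReal_mul (mul_nonneg hΓ h)]
  congr 1
  ring

theorem enorm_potentialKernel_eq (hd : 1 ≤ d) {x y : EuclideanSpace ℝ (Fin d)} (hxy : x ≠ y) :
    ‖potentialKernel d ((d : ℝ) / 2) x y‖ₑ = ∫⁻ t in Set.Ioi (0 : ℝ),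
      ENNReal.ofReal ((Real.Gamma ((d : ℝ) / 2))⁻¹ * t ^ ((d : ℝ) / 2 - 1)) *
        ENNReal.ofReal (heatKernel d t x y) := by
  have hσ := half_dim_pos hd
  have hΓ := inv_nonneg.2 (Real.Gamma_pos_of_pos hσ).le
  rw [Real.enorm_eq_ofReal (potentialKernel_nonneg hσ x y), potentialKernel, ← integral_const_mul,
    ofReal_integral_eq_lintegral_ofReal
      ((integrableOn_heatKernel_mul_rpow hd hxy).const_mul _)]
  · refine setLIntegral_congr_fun measurableSet_Ioi fun t (ht : 0 < t) => ?_
    rw [← ENNReal.ofReal_mul (mul_nonneg hΓ (Real.rpow_nonneg ht.le _))]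
    congr 1
    ring
  · exact (ae_restrict_mem measurableSet_Ioi).mono fun t (ht : 0 < t) =>
      mul_nonneg hΓ (mul_nonneg (heatKernel_nonneg ht x y) (Real.rpow_nonneg ht.le _))

theorem lintegral_lintegral_heatKernel_mul_swap (σ : ℝ) {F : EuclideanSpace ℝ (Fin d) → ℝ≥0∞}
    (hF : Measurable F) (x : EuclideanSpace ℝ (Fin d)) :
    ∫⁻ y, (∫⁻ t in Set.Ioi (0 : ℝ),
        ENNReal.ofReal ((Real.Gamma σ)⁻¹ * t ^ (σ - 1)) * ENNReal.ofReal (heatKernel d t x y)) * F y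
      = ∫⁻ t in Set.Ioi (0 : ℝ), ENNReal.ofReal ((Real.Gamma σ)⁻¹ * t ^ (σ - 1)) *
          ∫⁻ y, ENNReal.ofReal (heatKernel d t x y) * F y := by
  have hG : Measurable fun z : EuclideanSpace ℝ (Fin d) × ℝ =>
      ENNReal.ofReal (heatKernel d z.2 x z.1) := by fun_prop
  have hw : Measurable fun t : ℝ => ENNReal.ofReal ((Real.Gamma σ)⁻¹ * t ^ (σ - 1)) := by
    fun_prop
  have hGy : ∀ y, Measurable fun t => ENNReal.ofReal (heatKernel d t x y) := fun y => by fun_prop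
  have hGt : ∀ t, Measurable fun y => ENNReal.ofReal (heatKernel d t x y) := fun t => by fun_prop
  have h1 : ∀ y, (∫⁻ t in Set.Ioi (0 : ℝ), ENNReal.ofReal ((Real.Gamma σ)⁻¹ * t ^ (σ - 1)) *
      ENNReal.ofReal (heatKernel d t x y)) * F y = ∫⁻ t in Set.Ioi (0 : ℝ),
        ENNReal.ofReal ((Real.Gamma σ)⁻¹ * t ^ (σ - 1)) * ENNReal.ofReal (heatKernel d t x y)
          * F y := fun y => (lintegral_mul_const _ (hw.mul (hGy y))).symm
  have h2 : ∀ t, ENNReal.ofReal ((Real.Gamma σ)⁻¹ * t ^ (σ - 1)) *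
      ∫⁻ y, ENNReal.ofReal (heatKernel d t x y) * F y = ∫⁻ y,
        ENNReal.ofReal ((Real.Gamma σ)⁻¹ * t ^ (σ - 1)) * (ENNReal.ofReal (heatKernel d t x y)
          * F y) := fun t => (lintegral_const_mul _ ((hGt t).mul hF)).symm
  simp only [h1, h2]
  rw [lintegral_lintegral_swap]
  · simp only [mul_assoc]
  · exact Measurable.aemeasurable (by fun_prop)

theorem potentialMajorant_le {σ : ℝ} (hσ : 0 < σ) {F : EuclideanSpace ℝ (Fin d) → ℝ≥0∞}
    (hF : Measurable F) (x : EuclideanSpace ℝ (Fin d)) :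
    potentialMajorant d σ F x ≤
      ∫⁻ t in Set.Ioi (0 : ℝ), ENNReal.ofReal ((Real.Gamma σ)⁻¹ * t ^ (σ - 1)) *
        ∫⁻ y, ENNReal.ofReal (heatKernel d t x y) * F y := by
  rw [← lintegral_lintegral_heatKernel_mul_swap σ hF]
  exact lintegral_mono fun y => mul_le_mul_left (enorm_potentialKernel_le hσ x y) _

theorem integrableOn_rpow_mul_exp_neg_mul {s b : ℝ} (hs : -1 < s) (hb : 0 < b) :
    IntegrableOn (fun t : ℝ => t ^ s * Real.exp (-b * t)) (Set.Ioi 0) := by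
  simpa using integrableOn_rpow_mul_exp_neg_mul_rpow hs zero_lt_one hb

theorem exists_eLpNorm_potentialMajorant_le (hd : 1 ≤ d) {p q : ℝ≥0∞} (hp : 1 ≤ p) (hq : 1 ≤ q)
    (hpq : |p.toReal⁻¹ - q.toReal⁻¹| < 1) :
    ∃ C : ℝ≥0, ∀ F : EuclideanSpace ℝ (Fin d) → ℝ≥0∞, AEMeasurable F →
      eLpNorm (potentialMajorant d ((d : ℝ) / 2) F) q volume ≤ C * eLpNorm F p volume := by
  have hσ := half_dim_pos hd
  have hΓ := inv_pos.2 (Real.Gamma_pos_of_pos hσ)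
  set θ := |p.toReal⁻¹ - q.toReal⁻¹| with hθ
  set b : ℝ → ℝ := fun t => (Real.Gamma ((d : ℝ) / 2))⁻¹ * t ^ ((d : ℝ) / 2 - 1) *
    (rowBound d t * (t ^ (-((d : ℝ) / 2))) ^ θ) with hb
  have hbm : Measurable b := by
    simp only [hb, rowBound]
    fun_prop
  have hbint : IntegrableOn b (Set.Ioi 0) := by
    -- The only use of `θ < 1`: the exponent of `t` in `b` is `(1 - θ)d/2 - 1`.
    have hs : -1 < (d : ℝ) / 2 - 1 - (d : ℝ) / 2 * θ := by nlinarith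
    refine IntegrableOn.congr_fun ((integrableOn_rpow_mul_exp_neg_mul hs hσ).const_mul
      ((Real.Gamma ((d : ℝ) / 2))⁻¹ * (2 * Real.pi) ^ ((d : ℝ) / 2)))
        (fun t (ht : 0 < t) => ?_) measurableSet_Ioi
    simp only [hb, rowBound]
    rw [← Real.rpow_mul ht.le, sub_eq_add_neg _ ((d : ℝ) / 2 * θ), Real.rpow_add ht,
      neg_mul ((d : ℝ) / 2) θ]
    ring
  have hbpos : ∀ t, 0 < t → 0 < b t := fun t ht =>
    mul_pos (mul_pos hΓ (Real.rpow_pos_of_pos ht _))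
      (mul_pos (rowBound_pos t) (Real.rpow_pos_of_pos (Real.rpow_pos_of_pos ht _) _))
  have hfin : ∫⁻ t in Set.Ioi (0 : ℝ), ENNReal.ofReal (b t) < ∞ := hbint.lintegral_lt_top
  refine ⟨(∫⁻ t in Set.Ioi (0 : ℝ), ENNReal.ofReal (b t)).toNNReal, fun F hF => ?_⟩
  rw [ENNReal.coe_toNNReal hfin.ne]
  have hcongr : potentialMajorant d ((d : ℝ) / 2) F =
      potentialMajorant d ((d : ℝ) / 2) (hF.mk F) := by
    funext x
    refine lintegral_congr_ae ?_
    filter_upwards [hF.ae_eq_mk] with y hy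
    rw [hy]
  rw [hcongr, eLpNorm_congr_ae hF.ae_eq_mk]
  have hFm := hF.measurable_mk
  generalize hF.mk F = F at *
  have hm : Measurable (Function.uncurry fun (t : ℝ) (x : EuclideanSpace ℝ (Fin d)) =>
      ENNReal.ofReal ((Real.Gamma ((d : ℝ) / 2))⁻¹ * t ^ ((d : ℝ) / 2 - 1)) *
        ∫⁻ y, ENNReal.ofReal (heatKernel d t x y) * F y) := by
    refine Measurable.mul (by fun_prop) ?_
    have : Measurable fun z : (ℝ × EuclideanSpace ℝ (Fin d)) × EuclideanSpace ℝ (Fin d) =>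
        ENNReal.ofReal (heatKernel d z.1.1 z.1.2 z.2) * F z.2 := by fun_prop
    exact this.lintegral_prod_right'
  refine (eLpNorm_mono_enorm fun x => ?_).trans
    (eLpNorm_lintegral_le (ν := volume.restrict (Set.Ioi (0 : ℝ))) hm hbm.ennreal_ofReal ?_ ?_ hq
      (N := eLpNorm F p volume) ?_)
  · simpa using potentialMajorant_le hσ hFm x
  · exact (ae_restrict_mem measurableSet_Ioi).mono fun t ht =>
      (ENNReal.ofReal_pos.2 (hbpos t ht)).ne'
  · exact Filter.Eventually.of_forall fun t => ENNReal.ofReal_ne_top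
  · refine (ae_restrict_mem measurableSet_Ioi).mono fun t (ht : 0 < t) => ?_
    have hw := mul_nonneg hΓ.le (Real.rpow_nonneg ht.le ((d : ℝ) / 2 - 1))
    simp only [hb]
    rw [ENNReal.ofReal_mul hw, mul_assoc]
    refine le_trans ?_ (mul_le_mul_right (eLpNorm_heatKernel_le ht hFm.aemeasurable hp hq) _)
    refine (eLpNorm_le_nnreal_smul_eLpNorm_of_ae_le_mul'
      (c := Real.toNNReal ((Real.Gamma ((d : ℝ) / 2))⁻¹ * t ^ ((d : ℝ) / 2 - 1)))
      (g := fun x => ∫⁻ y, ENNReal.ofReal (heatKernel d t x y) * F y)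
      (Filter.Eventually.of_forall fun x => ?_) q).trans_eq ?_
    · simp [ENNReal.ofReal]
    · rw [ENNReal.smul_def]; simp [ENNReal.ofReal]

/-- The case `q = p`, where `θ = 0`, bounds the majorant in `L^p`; hence it is finite almost
everywhere, which is absolute convergence. -/
theorem inPotentialDomain (hd : 1 ≤ d) {𝕜 : Type*} [RCLike 𝕜] {p : ℝ≥0∞} (hp : 1 ≤ p)
    {f : EuclideanSpace ℝ (Fin d) → 𝕜} (hf : MemLp f p) :
    InPotentialDomain d ((d : ℝ) / 2) f := by
  obtain ⟨C, hC⟩ := exists_eLpNorm_potentialMajorant_le hd hp hp (by simp)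
  have h1 : eLpNorm (potentialMajorant d ((d : ℝ) / 2) fun y => ‖f y‖ₑ) p volume < ∞ := by
    refine (hC _ hf.1.enorm).trans_lt (ENNReal.mul_lt_top ENNReal.coe_lt_top ?_)
    rw [eLpNorm_enorm]
    exact hf.2
  have hkf : AEStronglyMeasurable (fun z : EuclideanSpace ℝ (Fin d) × EuclideanSpace ℝ (Fin d) =>
      potentialKernel d ((d : ℝ) / 2) z.1 z.2 • f z.2) (volume.prod volume) :=
    (stronglyMeasurable_potentialKernel _).aestronglyMeasurable.smul hf.1.comp_snd
  have hM : AEMeasurable (potentialMajorant d ((d : ℝ) / 2) fun y => ‖f y‖ₑ) := by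
    have := hkf.enorm.lintegral_prod_right'
    simp only [enorm_smul] at this
    exact this
  have h2 : ∀ᵐ x, potentialMajorant d ((d : ℝ) / 2) (fun y => ‖f y‖ₑ) x < ∞ := by
    by_cases hp' : p = ∞
    · subst hp'
      rw [eLpNorm_exponent_top] at h1
      filter_upwards [enorm_ae_le_eLpNormEssSup
        (potentialMajorant d ((d : ℝ) / 2) fun y => ‖f y‖ₑ) volume] with x hx
      exact hx.trans_lt h1
    · have hp0 : 0 < p.toReal := ENNReal.toReal_pos (zero_lt_one.trans_le hp).ne' hp'
      have h3 := lintegral_rpow_eq_eLpNorm_rpow (μ := volume)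
        (f := potentialMajorant d ((d : ℝ) / 2) fun y => ‖f y‖ₑ) hp hp'
      filter_upwards [ae_lt_top' (hM.pow_const p.toReal)
        (h3 ▸ ENNReal.rpow_ne_top_of_nonneg hp0.le h1.ne)] with x hx
      exact (ENNReal.rpow_lt_top_iff_of_pos hp0).1 hx
  filter_upwards [h2] with x hx
  refine ⟨((stronglyMeasurable_potentialKernel _).comp_measurable
    (measurable_const.prodMk measurable_id)).aestronglyMeasurable.smul hf.1, ?_⟩
  rw [hasFiniteIntegral_iff_enorm]
  simp only [enorm_smul]
  exact hx

/-- The reciprocals lie in `[0, 1]`, with `∞.toReal⁻¹ = 0` as it should be, so their distance is `1`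
only at opposite endpoints. -/
theorem abs_inv_toReal_sub_inv_toReal_lt_one {p q : ℝ≥0∞} (hp : 1 ≤ p) (hq : 1 ≤ q)
    (h1 : (p, q) ≠ (∞, 1)) (h2 : (p, q) ≠ (1, ∞)) : |p.toReal⁻¹ - q.toReal⁻¹| < 1 := by
  have key : ∀ r : ℝ≥0∞, 1 ≤ r → 0 ≤ r.toReal⁻¹ ∧ r.toReal⁻¹ ≤ 1 ∧
      (r ≠ 1 → r.toReal⁻¹ < 1) ∧ (r ≠ ∞ → 0 < r.toReal⁻¹) := by
    intro r hr
    by_cases hr' : r = ∞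
    · subst hr'
      simp
    · have hr1 : 1 ≤ r.toReal := by
        simpa using (ENNReal.toReal_le_toReal ENNReal.one_ne_top hr').2 hr
      refine ⟨by positivity, inv_le_one_of_one_le₀ hr1, fun hne => inv_lt_one_of_one_lt₀ ?_,
        fun _ => by positivity⟩
      refine lt_of_le_of_ne hr1 fun h => hne ?_
      rw [← ENNReal.ofReal_toReal hr', ← h, ENNReal.ofReal_one]
  obtain ⟨p0, p1, p2, p3⟩ := key p hp
  obtain ⟨q0, q1, q2, q3⟩ := key q hq
  rw [abs_lt]
  constructor
  · by_cases hq1 : q = 1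
    · have := p3 fun h => h1 (by rw [h, hq1])
      linarith
    · linarith [q2 hq1]
  · by_cases hp1 : p = 1
    · have := q3 fun h => h2 (by rw [h, hp1])
      linarith
    · linarith [p2 hp1]

theorem isStrongType_potentialOperator (hd : 1 ≤ d) {𝕜 : Type*} [RCLike 𝕜] {p q : ℝ≥0∞}
    (hp : 1 ≤ p) (hq : 1 ≤ q) (h1 : (p, q) ≠ (∞, 1)) (h2 : (p, q) ≠ (1, ∞)) :
    IsStrongType (potentialOperator d ((d : ℝ) / 2) (𝕜 := 𝕜)) p q := by
  obtain ⟨C, hC⟩ := exists_eLpNorm_potentialMajorant_le hd hp hq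
    (abs_inv_toReal_sub_inv_toReal_lt_one hp hq h1 h2)
  refine ⟨C, fun f hf => ?_⟩
  have h : eLpNorm (potentialOperator d ((d : ℝ) / 2) f) q volume ≤ C * eLpNorm f p volume := by
    have := hC _ hf.1.enorm
    rw [eLpNorm_enorm] at this
    refine (eLpNorm_mono_enorm fun x => ?_).trans this
    simpa using enorm_potentialOperator_le ((d : ℝ) / 2) f x
  exact ⟨⟨aestronglyMeasurable_potentialOperator _ hf.1,
    h.trans_lt (ENNReal.mul_lt_top ENNReal.coe_lt_top hf.2)⟩, h⟩

end Potential

/-! ### The singular pairs `(∞, 1)` and `(1, ∞)` -/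

section Endpoints

variable {d : ℕ}

theorem div_one_add_le_tanh {u : ℝ} (hu : 0 ≤ u) : u / (1 + u) ≤ Real.tanh u := by
  have h1 : 2 * u + 1 ≤ Real.exp (2 * u) := Real.add_one_le_exp (2 * u)
  have h2 : Real.exp (2 * u) = Real.exp u * Real.exp u := by
    rw [← Real.exp_add]; ring_nf
  have h3 : Real.exp u * Real.exp (-u) = 1 := by rw [← Real.exp_add]; simp
  have h4 := Real.exp_pos u
  have h5 := Real.exp_pos (-u)
  rw [Real.tanh_eq_sinh_div_cosh, div_le_div_iff₀ (by linarith) (Real.cosh_pos u),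
    Real.cosh_eq, Real.sinh_eq]
  have h6 : (2 * u + 1) * Real.exp (-u) ≤ Real.exp u := by
    calc (2 * u + 1) * Real.exp (-u) ≤ Real.exp (2 * u) * Real.exp (-u) := by gcongr
      _ = Real.exp u := by rw [h2, mul_assoc, h3, mul_one]
  linarith

/-- `tanh(2t)/2` is at least `t/3` for `t ≤ 1` and at least `1/3` for `t ≥ 1`; the sum covers both
regimes. -/
theorem exp_neg_tanh_mul_le {t : ℝ} (ht : 0 < t) {r : ℝ} (hr : 0 ≤ r) :
    Real.exp (-(Real.tanh (2 * t) / 2) * r) ≤ Real.exp (-(r / 3) * t) + Real.exp (-(r / 3)) := by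
  have h := div_one_add_le_tanh (by linarith : 0 ≤ 2 * t)
  rcases le_total t 1 with h1 | h1
  · have h2 : t / 3 ≤ Real.tanh (2 * t) / 2 := by
      have : 2 * (t / 3) ≤ 2 * t / (1 + 2 * t) := by
        rw [le_div_iff₀ (by linarith)]
        nlinarith
      linarith
    have := mul_le_mul_of_nonneg_right h2 hr
    refine (Real.exp_le_exp.2 ?_).trans (le_add_of_nonneg_right (Real.exp_pos _).le)
    linarith
  · have h2 : 1 / 3 ≤ Real.tanh (2 * t) / 2 := by
      have : 2 / 3 ≤ 2 * t / (1 + 2 * t) := by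
        rw [div_le_div_iff₀ (by norm_num) (by linarith)]
        linarith
      linarith
    have := mul_le_mul_of_nonneg_right h2 hr
    refine (Real.exp_le_exp.2 ?_).trans (le_add_of_nonneg_left (Real.exp_pos _).le)
    linarith

theorem lintegral_rpow_mul_exp_neg_mul {σ b : ℝ} (hσ : 0 < σ) (hb : 0 < b) :
    ∫⁻ t in Set.Ioi (0 : ℝ), ENNReal.ofReal (t ^ (σ - 1) * Real.exp (-b * t)) =
      ENNReal.ofReal (b ^ (-σ) * Real.Gamma σ) := by
  rw [← ofReal_integral_eq_lintegral_ofReal (integrableOn_rpow_mul_exp_neg_mul (by linarith) hb)]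
  · have h := Real.integral_rpow_mul_exp_neg_mul_Ioi hσ hb
    simp only [← neg_mul] at h
    rw [h, one_div, Real.inv_rpow hb.le, Real.rpow_neg hb.le]
  · exact (ae_restrict_mem measurableSet_Ioi).mono fun t (ht : 0 < t) =>
      mul_nonneg (Real.rpow_nonneg ht.le _) (Real.exp_pos _).le

theorem exp_neg_mul_rpow_neg_le {σ u : ℝ} (hσ : 0 < σ) (hu : 0 < u) :
    Real.exp (-u) * σ ^ (-σ) ≤ u ^ (-σ) := by
  have h1 : u / σ ≤ Real.exp (u / σ) := by linarith [Real.add_one_le_exp (u / σ)]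
  have h2 : (u / σ) ^ σ ≤ Real.exp u := by
    refine (Real.rpow_le_rpow (by positivity) h1 hσ.le).trans_eq ?_
    rw [← Real.exp_mul, div_mul_cancel₀ _ hσ.ne']
  rw [Real.div_rpow hu.le hσ.le] at h2
  rw [Real.exp_neg, Real.rpow_neg hσ.le, Real.rpow_neg hu.le, ← mul_inv]
  have h3 : 0 < u ^ σ := Real.rpow_pos_of_pos hu _
  have h4 : 0 < σ ^ σ := Real.rpow_pos_of_pos hσ _
  exact inv_anti₀ h3 ((div_le_iff₀ h4).1 h2)

/-- With `u = ‖x‖²/3`, the small-time term gives `∫ t^(d/2 - 1) e^(-ut) dt = Γ(d/2) u^(-d/2)`, a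
multiple of `‖x‖^(-d)`. The large-time term carries `e^(-u)`, which `exp_neg_mul_rpow_neg_le`
absorbs into the same power. -/
theorem lintegral_enorm_potentialKernel_le (hd : 1 ≤ d) {x : EuclideanSpace ℝ (Fin d)}
    (hx : x ≠ 0) :
    ∫⁻ y, ‖potentialKernel d ((d : ℝ) / 2) x y‖ₑ ≤
      ENNReal.ofReal (2 * (6 * Real.pi) ^ ((d : ℝ) / 2) * (‖x‖ ^ d)⁻¹) := by
  have hσ := half_dim_pos hd
  set σ := (d : ℝ) / 2 with hσd
  have hΓ := Real.Gamma_pos_of_pos hσ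
  have hx0 : 0 < ‖x‖ := norm_pos_iff.2 hx
  set u := ‖x‖ ^ 2 / 3 with hu
  have hu0 : 0 < u := by positivity
  have h := potentialMajorant_le hσ (F := fun _ => (1 : ℝ≥0∞)) measurable_const x
  simp only [potentialMajorant, mul_one] at h
  have hpt : ∀ t, 0 < t → ENNReal.ofReal ((Real.Gamma σ)⁻¹ * t ^ (σ - 1)) *
      ∫⁻ y, ENNReal.ofReal (heatKernel d t x y) ≤
      ENNReal.ofReal ((Real.Gamma σ)⁻¹ * (2 * Real.pi) ^ σ) *
        (ENNReal.ofReal (t ^ (σ - 1) * Real.exp (-u * t)) +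
          ENNReal.ofReal (Real.exp (-u)) *
            ENNReal.ofReal (t ^ (σ - 1) * Real.exp (-σ * t))) := by
    intro t ht
    have ht1 : 0 < t ^ (σ - 1) := Real.rpow_pos_of_pos ht _
    refine (mul_le_mul_right (lintegral_heatKernel_le ht x) _).trans ?_
    rw [← ENNReal.ofReal_mul (by positivity), ← ENNReal.ofReal_mul (by positivity),
      ← ENNReal.ofReal_add (by positivity) (by positivity), ← ENNReal.ofReal_mul (by positivity)]
    refine ENNReal.ofReal_le_ofReal ?_
    -- The decay `e^(-σt)` is dropped from the small-time term only; the other term needs it to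
    -- converge.
    have h1 : Real.exp (-σ * t) ≤ 1 := Real.exp_le_one_iff.2 (by nlinarith)
    have h2 := exp_neg_tanh_mul_le ht (sq_nonneg ‖x‖)
    rw [← hu] at h2
    rw [rowBound, ← hσd]
    calc (Real.Gamma σ)⁻¹ * t ^ (σ - 1) * ((2 * Real.pi) ^ σ * Real.exp (-σ * t) *
          Real.exp (-(Real.tanh (2 * t) / 2) * ‖x‖ ^ 2))
        ≤ (Real.Gamma σ)⁻¹ * t ^ (σ - 1) * ((2 * Real.pi) ^ σ * Real.exp (-σ * t) *
          (Real.exp (-u * t) + Real.exp (-u))) := by gcongr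
      _ = (Real.Gamma σ)⁻¹ * (2 * Real.pi) ^ σ * (t ^ (σ - 1) * Real.exp (-u * t) *
          Real.exp (-σ * t) + Real.exp (-u) * (t ^ (σ - 1) * Real.exp (-σ * t))) := by ring
      _ ≤ _ := by
          have h3 : 0 ≤ t ^ (σ - 1) * Real.exp (-u * t) := by positivity
          exact mul_le_mul_of_nonneg_left
            (add_le_add_left (mul_le_of_le_one_right h3 h1) _) (by positivity)
  refine (h.trans (setLIntegral_mono' measurableSet_Ioi hpt)).trans ?_
  rw [lintegral_const_mul _ (by fun_prop), lintegral_add_left (by fun_prop),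
    lintegral_const_mul _ (by fun_prop), lintegral_rpow_mul_exp_neg_mul hσ hu0,
    lintegral_rpow_mul_exp_neg_mul hσ hσ, ← ENNReal.ofReal_mul (Real.exp_pos _).le,
    ← ENNReal.ofReal_add (by positivity) (by positivity), ← ENNReal.ofReal_mul (by positivity)]
  refine ENNReal.ofReal_le_ofReal ?_
  have hux : u ^ (-σ) = 3 ^ σ * (‖x‖ ^ d)⁻¹ := by
    rw [hu, Real.rpow_neg (by positivity), Real.div_rpow (by positivity) (by norm_num), inv_div,
      div_eq_mul_inv]
    congr 2
    rw [← Real.rpow_natCast, ← Real.rpow_mul hx0.le, ← Real.rpow_natCast, hσd]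
    congr 1
    push_cast
    ring
  calc (Real.Gamma σ)⁻¹ * (2 * Real.pi) ^ σ *
        (u ^ (-σ) * Real.Gamma σ + Real.exp (-u) * (σ ^ (-σ) * Real.Gamma σ))
      = (2 * Real.pi) ^ σ * (u ^ (-σ) + Real.exp (-u) * σ ^ (-σ)) := by
        field_simp
    _ ≤ (2 * Real.pi) ^ σ * (u ^ (-σ) + u ^ (-σ)) := by
        gcongr
        exact exp_neg_mul_rpow_neg_le hσ hu0
    _ = 2 * ((2 * Real.pi) ^ σ * 3 ^ σ) * (‖x‖ ^ d)⁻¹ := by rw [hux]; ring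
    _ = _ := by
        rw [← Real.mul_rpow (by positivity) (by norm_num)]
        congr 3
        ring

/-- A function bounded by `cN‖x‖^(-d)` exceeds `l` only in a ball of radius `(cN/l)^(1/d)`, whose
volume is proportional to `N/l`. -/
theorem isWeakType_potentialOperator_top_one (hd : 1 ≤ d) {𝕜 : Type*} [RCLike 𝕜] :
    IsWeakType (potentialOperator d ((d : ℝ) / 2) (𝕜 := 𝕜)) ∞ 1 := by
  set c : ℝ := 2 * (6 * Real.pi) ^ ((d : ℝ) / 2) with hc
  have hc0 : 0 < c := by positivity
  have : Nonempty (Fin d) := ⟨⟨0, hd⟩⟩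
  have hV : volume (Metric.ball (0 : EuclideanSpace ℝ (Fin d)) 1) ≠ ∞ := measure_ball_lt_top.ne
  refine ⟨c.toNNReal * (volume (Metric.ball (0 : EuclideanSpace ℝ (Fin d)) 1)).toNNReal,
    fun f hf => ⟨aestronglyMeasurable_potentialOperator _ hf.1, fun _ l hl => ?_,
      fun h => absurd h ENNReal.one_ne_top⟩⟩
  set N := (eLpNorm f ∞ volume).toReal with hN
  have hNf : eLpNorm f ∞ volume = ENNReal.ofReal N := (ENNReal.ofReal_toReal hf.2.ne).symm
  have hN0 : 0 ≤ N := ENNReal.toReal_nonneg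
  have hpt : ∀ x ≠ 0, ‖potentialOperator d ((d : ℝ) / 2) f x‖ ≤ c * (‖x‖ ^ d)⁻¹ * N := by
    intro x hx
    have h1 : potentialMajorant d ((d : ℝ) / 2) (fun y => ‖f y‖ₑ) x ≤
        (∫⁻ y, ‖potentialKernel d ((d : ℝ) / 2) x y‖ₑ) * ENNReal.ofReal N := by
      rw [← lintegral_mul_const' _ _ ENNReal.ofReal_ne_top]
      refine lintegral_mono_ae ?_
      rw [← hNf, eLpNorm_exponent_top]
      filter_upwards [enorm_ae_le_eLpNormEssSup f volume] with y hy
      gcongr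
    have h2 := (enorm_potentialOperator_le ((d : ℝ) / 2) f x).trans
      (h1.trans (mul_le_mul_left (lintegral_enorm_potentialKernel_le hd hx) _))
    rw [← ENNReal.ofReal_mul (by positivity), ← ofReal_norm,
      ENNReal.ofReal_le_ofReal_iff (by positivity)] at h2
    exact h2
  set R := c * N / l with hR
  have hR0 : 0 ≤ R := by positivity
  have hd0 : d ≠ 0 := by omega
  have hsub : {x | l < ‖potentialOperator d ((d : ℝ) / 2) f x‖} ⊆
      Metric.closedBall 0 (R ^ (d : ℝ)⁻¹) := by
    intro x (hx : l < _)
    rw [mem_closedBall_zero_iff]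
    by_cases hx0 : x = 0
    · rw [hx0, norm_zero]
      positivity
    have hxn : 0 < ‖x‖ := norm_pos_iff.2 hx0
    have h3 : ‖x‖ ^ d ≤ R := by
      have h4 := hx.le.trans (hpt x hx0)
      rw [hR, le_div_iff₀ hl]
      have h5 : c * (‖x‖ ^ d)⁻¹ * N = c * N / ‖x‖ ^ d := by ring
      rw [h5, le_div_iff₀ (by positivity)] at h4
      linarith
    calc ‖x‖ = (‖x‖ ^ d) ^ (d : ℝ)⁻¹ := (Real.pow_rpow_inv_natCast hxn.le hd0).symm
      _ ≤ _ := Real.rpow_le_rpow (by positivity) h3 (by positivity)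
  refine (measure_mono hsub).trans ?_
  rw [Measure.addHaar_closedBall _ _ (by positivity), finrank_euclideanSpace_fin,
    Real.rpow_inv_natCast_pow hR0 hd0, hNf, ← ENNReal.ofReal_div_of_pos hl, ENNReal.toReal_one,
    ENNReal.rpow_one, ENNReal.coe_mul, ENNReal.coe_toNNReal hV, mul_right_comm]
  refine le_of_eq ?_
  congr 1
  rw [hR, mul_div_assoc, ENNReal.ofReal_mul hc0.le]
  rfl

theorem potentialOperator_indicator_one {𝕜 : Type*} [RCLike 𝕜] (σ : ℝ)
    {E : Set (EuclideanSpace ℝ (Fin d))} (hE : MeasurableSet E) (x : EuclideanSpace ℝ (Fin d)) :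
    potentialOperator d σ (E.indicator fun _ => (1 : 𝕜)) x =
      ((∫ y in E, potentialKernel d σ x y : ℝ) : 𝕜) := by
  rw [potentialOperator, ← integral_indicator hE, ← integral_ofReal]
  refine integral_congr_ae (Filter.Eventually.of_forall fun y => ?_)
  by_cases hy : y ∈ E <;> simp [hy, RCLike.real_smul_eq_coe_mul]

theorem integrableOn_of_integrable_smul_indicator {𝕜 : Type*} [RCLike 𝕜] {σ : ℝ}
    {E : Set (EuclideanSpace ℝ (Fin d))} (hE : MeasurableSet E) {x : EuclideanSpace ℝ (Fin d)}
    (h : Integrable fun y => potentialKernel d σ x y • E.indicator (fun _ => (1 : 𝕜)) y) :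
    IntegrableOn (potentialKernel d σ x) E := by
  rw [← integrable_indicator_iff hE]
  refine (integrable_norm_iff (Measurable.aestronglyMeasurable ?_)).1 (h.norm.congr ?_)
  · exact ((stronglyMeasurable_potentialKernel σ).comp_measurable
      measurable_prodMk_left).measurable.indicator hE
  · refine Filter.Eventually.of_forall fun y => ?_
    by_cases hy : y ∈ E <;> simp [hy, norm_smul]

/-- Tested on `f = 1`: by Tonelli the `L^1` norm of the potential is at least a multiple of `∫_0^1
dt/t`. -/
theorem not_isStrongType_potentialOperator_top_one (hd : 1 ≤ d) {𝕜 : Type*} [RCLike 𝕜] :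
    ¬ IsStrongType (potentialOperator d ((d : ℝ) / 2) (𝕜 := 𝕜)) ∞ 1 := by
  rintro ⟨C, hC⟩
  have hσ := half_dim_pos hd
  have hΓ := inv_pos.2 (Real.Gamma_pos_of_pos hσ)
  have : Nonempty (Fin d) := ⟨⟨0, hd⟩⟩
  set f : EuclideanSpace ℝ (Fin d) → 𝕜 := Set.univ.indicator fun _ => 1 with hf
  have hfm : MemLp f ∞ := by
    rw [hf, Set.indicator_univ]
    exact memLp_top_const 1
  have h1 : ∫⁻ x, ‖potentialOperator d ((d : ℝ) / 2) f x‖ₑ < ∞ := by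
    have := (hC f hfm).1.2
    rwa [eLpNorm_one_eq_lintegral_enorm] at this
  have h2 : ∀ᵐ x, ‖potentialOperator d ((d : ℝ) / 2) f x‖ₑ =
      ∫⁻ t in Set.Ioi (0 : ℝ),
        ENNReal.ofReal ((Real.Gamma ((d : ℝ) / 2))⁻¹ * t ^ ((d : ℝ) / 2 - 1)) *
        ∫⁻ y, ENNReal.ofReal (heatKernel d t x y) := by
    filter_upwards [inPotentialDomain hd le_top hfm] with x hx
    have hint := integrableOn_of_integrable_smul_indicator MeasurableSet.univ hx
    have hnn : ∀ y, 0 ≤ potentialKernel d ((d : ℝ) / 2) x y := potentialKernel_nonneg hσ x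
    rw [hf, potentialOperator_indicator_one _ MeasurableSet.univ, ← ofReal_norm,
      RCLike.norm_ofReal, abs_of_nonneg (integral_nonneg hnn),
      ofReal_integral_eq_lintegral_ofReal hint (Filter.Eventually.of_forall hnn),
      Measure.restrict_univ]
    have h := lintegral_lintegral_heatKernel_mul_swap ((d : ℝ) / 2)
      (F := fun _ => (1 : ℝ≥0∞)) measurable_const x
    simp only [mul_one] at h
    rw [← h]
    refine lintegral_congr_ae ?_
    filter_upwards [Measure.ae_ne volume x] with y hy
    rw [← enorm_potentialKernel_eq hd hy.symm, Real.enorm_eq_ofReal (hnn y)]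
  rw [lintegral_congr_ae h2, lintegral_lintegral_swap] at h1
  swap
  · refine Measurable.aemeasurable (Measurable.mul (by fun_prop) ?_)
    have : Measurable fun z : (EuclideanSpace ℝ (Fin d) × ℝ) × EuclideanSpace ℝ (Fin d) =>
        ENNReal.ofReal (heatKernel d z.1.2 z.1.1 z.2) := by fun_prop
    exact this.lintegral_prod_right'
  set c : ℝ := (Real.Gamma ((d : ℝ) / 2))⁻¹ * ((2 * Real.pi) ^ ((d : ℝ) / 2) *
    (2 * Real.cosh 2) ^ (-((d : ℝ) / 2))) with hc
  have hcosh := Real.cosh_pos 2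
  have hc0 : 0 < c := by positivity
  have h3 : ∫⁻ t in Set.Ioc (0 : ℝ) 1, ENNReal.ofReal (c * t⁻¹) < ∞ := by
    refine lt_of_le_of_lt ?_ h1
    refine le_trans ?_ (lintegral_mono_set (s := Set.Ioc 0 1) Set.Ioc_subset_Ioi_self)
    refine setLIntegral_mono' measurableSet_Ioc fun t ht => ?_
    have ht0 : 0 < t := ht.1
    have hm : Measurable fun x : EuclideanSpace ℝ (Fin d) =>
        ∫⁻ y, ENNReal.ofReal (heatKernel d t x y) := by
      have : Measurable fun z : EuclideanSpace ℝ (Fin d) × EuclideanSpace ℝ (Fin d) =>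
        ENNReal.ofReal (heatKernel d t z.1 z.2) := by fun_prop
      exact this.lintegral_prod_right'
    rw [lintegral_const_mul _ hm, lintegral_lintegral_heatKernel ht0,
      ← ENNReal.ofReal_mul (by positivity)]
    refine ENNReal.ofReal_le_ofReal ?_
    have h4 := sinh_two_mul_le ht0 ht.2
    have h7 := Real.rpow_le_rpow_of_nonpos (sinh_two_mul_pos ht0) h4 (neg_nonpos.2 hσ.le)
    rw [Real.mul_rpow (by positivity) ht0.le] at h7
    calc c * t⁻¹ = (Real.Gamma ((d : ℝ) / 2))⁻¹ * t ^ ((d : ℝ) / 2 - 1) *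
          ((2 * Real.pi) ^ ((d : ℝ) / 2) *
            ((2 * Real.cosh 2) ^ (-((d : ℝ) / 2)) * t ^ (-((d : ℝ) / 2)))) := by
          have : t⁻¹ = t ^ ((d : ℝ) / 2 - 1) * t ^ (-((d : ℝ) / 2)) := by
            rw [← Real.rpow_add ht0, ← Real.rpow_neg_one]
            ring_nf
          rw [this, hc]
          ring
      _ ≤ _ := by gcongr
  have h4 : IntegrableOn (fun t : ℝ => c * t⁻¹) (Set.Ioc 0 1) := by
    refine ⟨Measurable.aestronglyMeasurable (by fun_prop), ?_⟩
    rw [hasFiniteIntegral_iff_ofReal]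
    · exact h3
    · exact (ae_restrict_mem measurableSet_Ioc).mono fun t ht =>
        mul_nonneg hc0.le (inv_nonneg.2 ht.1.le)
  have h5 : IntervalIntegrable (fun t : ℝ => t⁻¹) volume 0 1 := by
    rw [intervalIntegrable_iff_integrableOn_Ioc_of_le zero_le_one]
    exact (integrable_const_mul_iff hc0.ne'.isUnit _).1 h4
  rw [intervalIntegrable_inv_iff] at h5
  simp at h5

/-- The potential kernel is unbounded near the diagonal at the origin. -/
theorem exists_forall_le_potentialKernel (hd : 1 ≤ d) (M : ℝ) :
    ∃ r : ℝ, 0 < r ∧ ∀ x y : EuclideanSpace ℝ (Fin d), ‖x‖ < r → ‖y‖ < r → x ≠ y →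
      M ≤ potentialKernel d ((d : ℝ) / 2) x y := by
  have hσ := half_dim_pos hd
  have hΓ := inv_pos.2 (Real.Gamma_pos_of_pos hσ)
  have hcosh := Real.cosh_pos 2
  have hcosh1 := Real.cosh_pos 1
  set c : ℝ := (2 * Real.pi * (2 * Real.cosh 2)) ^ (-((d : ℝ) / 2)) *
    Real.exp (-(1 + Real.cosh 1)) with hc
  have hc0 : 0 < c := by positivity
  -- `m` is the value of `∫ dt/t` needed to reach `|M|`, and `r` is chosen so that the integral over
  -- `(r², 1]` equals `m`.
  set m : ℝ := |M| / ((Real.Gamma ((d : ℝ) / 2))⁻¹ * c) with hm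
  have hm0 : 0 ≤ m := by positivity
  set r : ℝ := Real.exp (-(m / 2)) with hr
  have hr0 : 0 < r := Real.exp_pos _
  have hr2 : r ^ 2 = Real.exp (-m) := by
    rw [hr, ← Real.exp_nat_mul]
    congr 1
    push_cast
    ring
  have hr1 : r ^ 2 ≤ 1 := by
    rw [hr2, Real.exp_le_one_iff]
    linarith
  refine ⟨r, hr0, fun x y hx hy hxy => ?_⟩
  -- For `t > r²` one has `‖x - y‖² ≤ 4r² ≤ 4t`, so the Gaussian exponent stays above `-(1 + cosh
  -- 1)` and the integrand is comparable to `1/t` from below.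
  have hpt : ∀ t ∈ Set.Ioc (r ^ 2) 1, c * t⁻¹ ≤ heatKernel d t x y * t ^ ((d : ℝ) / 2 - 1) := by
    intro t ht
    have ht0 : 0 < t := lt_trans (by positivity) ht.1
    have hsinh := Real.sinh_pos_iff.2 ht0
    have h4 := sinh_two_mul_le ht0 ht.2
    have h7 : (2 * Real.pi * (2 * Real.cosh 2)) ^ (-((d : ℝ) / 2)) * t ^ (-((d : ℝ) / 2)) ≤
        (2 * Real.pi * Real.sinh (2 * t)) ^ (-((d : ℝ) / 2)) := by
      rw [← Real.mul_rpow (by positivity) ht0.le]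
      refine Real.rpow_le_rpow_of_nonpos (two_pi_mul_sinh_pos ht0) ?_ (neg_nonpos.2 hσ.le)
      rw [mul_assoc (2 * Real.pi)]
      gcongr
    have h8 : Real.tanh t * ‖x + y‖ ^ 2 ≤ 4 := by
      have h9 : ‖x + y‖ ^ 2 ≤ 4 := by
        have : ‖x + y‖ ≤ 2 * r := (norm_add_le x y).trans (by linarith)
        nlinarith [norm_nonneg (x + y)]
      nlinarith [Real.tanh_lt_one t, tanh_pos ht0, sq_nonneg ‖x + y‖]
    have h10 : Real.cosh t / Real.sinh t * ‖x - y‖ ^ 2 ≤ 4 * Real.cosh 1 := by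
      have h11 : ‖x - y‖ ^ 2 ≤ 4 * t := by
        have : ‖x - y‖ ≤ 2 * r := (norm_sub_le x y).trans (by linarith)
        nlinarith [norm_nonneg (x - y), ht.1]
      have h12 : Real.cosh t ≤ Real.cosh 1 := by
        rw [Real.cosh_le_cosh, abs_of_pos ht0, abs_of_pos one_pos]
        exact ht.2
      have h13 : Real.cosh t / Real.sinh t ≤ Real.cosh 1 / t := by
        gcongr
        exact Real.self_le_sinh_iff.2 ht0.le
      calc Real.cosh t / Real.sinh t * ‖x - y‖ ^ 2 ≤ Real.cosh 1 / t * (4 * t) := by gcongr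
        _ = 4 * Real.cosh 1 := by field_simp
    have h14 : Real.exp (-(1 + Real.cosh 1)) ≤ Real.exp (-(1 / 4) * (Real.tanh t * ‖x + y‖ ^ 2
        + (Real.cosh t / Real.sinh t) * ‖x - y‖ ^ 2)) :=
      Real.exp_le_exp.2 (by linarith)
    calc c * t⁻¹ = (2 * Real.pi * (2 * Real.cosh 2)) ^ (-((d : ℝ) / 2)) * t ^ (-((d : ℝ) / 2)) *
          Real.exp (-(1 + Real.cosh 1)) * t ^ ((d : ℝ) / 2 - 1) := by
          have : t⁻¹ = t ^ ((d : ℝ) / 2 - 1) * t ^ (-((d : ℝ) / 2)) := by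
            rw [← Real.rpow_add ht0, ← Real.rpow_neg_one]
            ring_nf
          rw [this, hc]
          ring
      _ ≤ _ := by
          rw [heatKernel]
          gcongr
  have hsub : Set.Ioc (r ^ 2) 1 ⊆ Set.Ioi (0 : ℝ) := fun t ht => lt_trans (by positivity) ht.1
  have hint := integrableOn_heatKernel_mul_rpow hd hxy
  have hinv : IntegrableOn (fun t : ℝ => c * t⁻¹) (Set.Ioc (r ^ 2) 1) := by
    refine Integrable.mono' (hint.mono_set hsub) (Measurable.aestronglyMeasurable (by fun_prop)) ?_
    refine (ae_restrict_mem measurableSet_Ioc).mono fun t ht => ?_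
    rw [Real.norm_of_nonneg (mul_nonneg hc0.le (inv_nonneg.2 (le_of_lt (hsub ht))))]
    exact hpt t ht
  have h1 : c * m ≤ ∫ t in Set.Ioi (0 : ℝ), heatKernel d t x y * t ^ ((d : ℝ) / 2 - 1) := by
    calc c * m = ∫ t in Set.Ioc (r ^ 2) 1, c * t⁻¹ := by
          rw [integral_const_mul, ← intervalIntegral.integral_of_le hr1,
            integral_inv_of_pos (by positivity) one_pos, hr2, one_div, ← Real.exp_neg, neg_neg,
            Real.log_exp]
      _ ≤ ∫ t in Set.Ioc (r ^ 2) 1, heatKernel d t x y * t ^ ((d : ℝ) / 2 - 1) :=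
          setIntegral_mono_on hinv (hint.mono_set hsub) measurableSet_Ioc hpt
      _ ≤ _ := by
          refine setIntegral_mono_set hint ?_ hsub.eventuallyLE
          exact (ae_restrict_mem measurableSet_Ioi).mono fun t (ht : 0 < t) =>
            mul_nonneg (heatKernel_nonneg ht x y) (Real.rpow_nonneg ht.le _)
  calc M ≤ |M| := le_abs_self M
    _ = (Real.Gamma ((d : ℝ) / 2))⁻¹ * (c * m) := by
        rw [hm]
        field_simp
    _ ≤ _ := by
        rw [potentialKernel]
        gcongr

theorem not_isRestrictedWeakType_potentialOperator_one_top (hd : 1 ≤ d) {𝕜 : Type*} [RCLike 𝕜] :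
    ¬ IsRestrictedWeakType (potentialOperator d ((d : ℝ) / 2) (𝕜 := 𝕜)) 1 ∞ := by
  rintro ⟨C, hC⟩
  have : Nonempty (Fin d) := ⟨⟨0, hd⟩⟩
  obtain ⟨r, hr, hK⟩ := exists_forall_le_potentialKernel hd ((C : ℝ) + 1)
  set E := Metric.ball (0 : EuclideanSpace ℝ (Fin d)) r with hE
  have hEm : MeasurableSet E := measurableSet_ball
  have hEt : volume E < ∞ := measure_ball_lt_top
  have hE0 : 0 < volume E := Metric.measure_ball_pos _ _ hr
  have hbound := (hC E hEm hEt).2.2 rfl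
  rw [eLpNorm_indicator_const hEm one_ne_zero ENNReal.one_ne_top, eLpNorm_exponent_top] at hbound
  simp only [enorm_one, ENNReal.toReal_one, div_one, ENNReal.rpow_one, one_mul] at hbound
  have hmem : MemLp (E.indicator fun _ => (1 : 𝕜)) 1 volume :=
    memLp_indicator_const 1 hEm 1 (Or.inr hEt.ne)
  -- Almost everywhere on the ball `E` the potential is at least `(C + 1)|E|`, against the assumed
  -- bound `C|E|`; so `E` would be null.
  have hae : ∀ᵐ x, ¬ x ∈ E := by
    filter_upwards [inPotentialDomain hd le_rfl hmem, enorm_ae_le_eLpNormEssSup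
      (potentialOperator d ((d : ℝ) / 2) (E.indicator fun _ => (1 : 𝕜))) volume] with x hx hxle hxE
    have hint := integrableOn_of_integrable_smul_indicator hEm hx
    have h1 : ((C : ℝ) + 1) * volume.real E ≤ ∫ y in E, potentialKernel d ((d : ℝ) / 2) x y := by
      rw [mul_comm, ← smul_eq_mul, ← setIntegral_const]
      refine setIntegral_mono_on_ae (integrableOn_const hEt.ne) hint hEm ?_
      filter_upwards [Measure.ae_ne volume x] with y hy hyE
      exact hK x y (mem_ball_zero_iff.1 hxE) (mem_ball_zero_iff.1 hyE) hy.symm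
    have h2 := hxle.trans hbound
    rw [potentialOperator_indicator_one _ hEm, ← ofReal_norm, RCLike.norm_ofReal] at h2
    have h3 : ENNReal.ofReal (((C : ℝ) + 1) * volume.real E) ≤ C * volume E :=
      (ENNReal.ofReal_le_ofReal (h1.trans (le_abs_self _))).trans h2
    have hEr : 0 < volume.real E := ENNReal.toReal_pos hE0.ne' hEt.ne
    rw [← ENNReal.ofReal_toReal hEt.ne, ← ENNReal.ofReal_coe_nnreal,
      ← ENNReal.ofReal_mul C.coe_nonneg, ENNReal.ofReal_le_ofReal_iff (by positivity)] at h3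
    change ((C : ℝ) + 1) * volume.real E ≤ C * volume.real E at h3
    linarith
  exact hE0.ne' (measure_eq_zero_iff_ae_notMem.2 hae)

end Endpoints

end HarmonicOscillator

theorem theorem3p3 {𝕜 : Type*} [RCLike 𝕜] (d : ℕ) (hd : 1 ≤ d) :
    -- the integral defining the potential kernel converges off the diagonal
    (∀ x y : EuclideanSpace ℝ (Fin d), x ≠ y →
      IntegrableOn (fun t : ℝ => HarmonicOscillator.heatKernel d t x y * t ^ ((d : ℝ) / 2 - 1))
        (Set.Ioi 0)) ∧
    -- every `L^p` is contained in the natural domain, and the image function is measurable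
    (∀ p : ℝ≥0∞, 1 ≤ p → ∀ f : EuclideanSpace ℝ (Fin d) → 𝕜, MemLp f p volume →
      HarmonicOscillator.InPotentialDomain d ((d : ℝ) / 2) f ∧
      AEStronglyMeasurable (HarmonicOscillator.potentialOperator d ((d : ℝ) / 2) f) volume) ∧
    -- boundedness from `L^p` to `L^q` outside the two singular pairs
    (∀ p q : ℝ≥0∞, 1 ≤ p → 1 ≤ q → (p, q) ≠ (∞, 1) → (p, q) ≠ (1, ∞) →
      HarmonicOscillator.IsStrongType
        (HarmonicOscillator.potentialOperator d ((d : ℝ) / 2) (𝕜 := 𝕜)) p q) ∧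
    -- the pair `(∞, 1)`
    HarmonicOscillator.IsWeakType
      (HarmonicOscillator.potentialOperator d ((d : ℝ) / 2) (𝕜 := 𝕜)) ∞ 1 ∧
    ¬ HarmonicOscillator.IsStrongType
      (HarmonicOscillator.potentialOperator d ((d : ℝ) / 2) (𝕜 := 𝕜)) ∞ 1 ∧
    -- the pair `(1, ∞)`
    ¬ HarmonicOscillator.IsRestrictedWeakType
      (HarmonicOscillator.potentialOperator d ((d : ℝ) / 2) (𝕜 := 𝕜)) 1 ∞ := by
  open HarmonicOscillator in
  exact ⟨fun x y hxy => integrableOn_heatKernel_mul_rpow hd hxy,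
    fun p hp f hf => ⟨inPotentialDomain hd hp hf,
      aestronglyMeasurable_potentialOperator _ hf.1⟩,
    fun p q hp hq h1 h2 => isStrongType_potentialOperator hd hp hq h1 h2,
    isWeakType_potentialOperator_top_one hd,
    not_isStrongType_potentialOperator_top_one hd,
    not_isRestrictedWeakType_potentialOperator_one_top hd⟩
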